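/- Let $\mathcal M=(\mathcal S,\mathcal A,P,r,g,b)$ be a constrained Markov decision process with finite state space $\mathcal S$, finite action space $\mathcal A$, transition kernel $P$, functions $r,g:\mathcal S\times\mathcal A\to[0,1]$ and threshold $b\in[0,1]$. Suppose that it is weakly communicating: some stationary randomized policy induces a Markov chain consisting of a single closed irreducible class together with states that are transient under all stationary policies. Let $\Pi$ be the set of stationary randomized policies and, for $f:\mathcal S\times\mathcal A\to\mathbb R$ and $\pi\in\Pi$, let $J_f^\pi(s)=\lim_{N\to\infty}\frac1N\mathbb E_\pi\big[\sum_{t=1}^N f(s_t,a_t)\mid s_1=s\big]$. Fix $s_1\in\mathcal S$, suppose that $J_g^\pi(s_1)\ge b$ for some $\pi\in\Pi$, and let $$J_r^*(s_1)=\sup\{J_r^\pi(s_1):\pi\in\Pi,\ J_g^\pi(s_1)\ge b\},\qquad D(\lambda)=\sup_{\pi\in\Pi}\big(J_r^\pi(s_1)+\lambda(J_g^\pi(s_1)-b)\big)\quad(\lambda\ge0).$$ Then $D$ has a minimizer over $[0,\infty)$. Let $\lambda^*$ be any such minimizer and let $J_{\lambda^*}^*(s_1)=\sup_{\pi\in\Pi}J^\pi_{r+\lambda^*(g-b)}(s_1)$.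 Then there is a function $v:\mathcal S\to\mathbb R$ such that for all $(s,a)\in\mathcal S\times\mathcal A$ $$J_{\lambda^*}^*(s_1)-r(s,a)\ \ge\ -\lambda^*(b-g(s,a))+\sum_{s'}P(s'|s,a)v(s')-v(s).\qquad(*)$$ Let $v^*_{\lambda^*}$ be any function satisfying $(*)$, and let $\mathrm{sp}(v)=\max_s v(s)-\min_s v(s)$. Let $T\in\mathbb N$ and $\delta\in(0,1]$, and let $s_1,a_1,\dots,s_T,a_T,s_{T+1}$ be the trajectory, started at $s_1$, of an agent that chooses its actions in any (history-dependent, randomized) way, where, conditionally on $(s_1,a_1,\dots,s_t,a_t)$, the state $s_{t+1}$ has law $P(\cdot|s_t,a_t)$ for every $t\le T$. With $\mathrm{Regret}(T)=\sum_{t=1}^T(J_r^*(s_1)-r(s_t,a_t))$ and $\mathrm{Violation}(T)=\sum_{t=1}^T(b-g(s_t,a_t))$, with probability at least $1-\delta$, $$\mathrm{Regret}(T)\ \ge\ -\lambda^*\,\mathrm{Violation}(T)-\mathrm{sp}(v^*_{\lambda^*})\sqrt{2T\log(1/\delta)}-\mathrm{sp}(v^*_{\lambda^*}).$$ -/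

import Mathlib

open MeasureTheory Filter

/-- A constrained Markov decision process with state space `S`, action space `A`, transition
kernel `P` (`P s a s'` is the probability of moving from `s` to `s'` under action `a`),
reward function `r`, constraint function `g` and constraint threshold `b`. -/
structure CMDP (S A : Type*) [Fintype S] where
  P : S → A → S → ℝ
  P_nonneg : ∀ s a s', 0 ≤ P s a s'
  P_sum : ∀ s a, ∑ s', P s a s' = 1
  r : S → A → ℝ
  r_mem : ∀ s a, r s a ∈ Set.Icc (0 : ℝ) 1
  g : S → A → ℝ
  g_mem : ∀ s a, g s a ∈ Set.Icc (0 : ℝ) 1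
  b : ℝ
  b_mem : b ∈ Set.Icc (0 : ℝ) 1

/-- A stationary randomized policy: `π.prob s a` is the probability of taking `a` in `s`. -/
structure StationaryPolicy (S A : Type*) [Fintype A] where
  prob : S → A → ℝ
  prob_nonneg : ∀ s a, 0 ≤ prob s a
  prob_sum : ∀ s, ∑ a, prob s a = 1

namespace CMDP

variable {S A : Type*} [Fintype S] [DecidableEq S] [Fintype A]

/-- `(P V)(s, a) = ∑ s', P(s' | s, a) V(s')`. -/
def applyP (M : CMDP S A) (V : S → ℝ) (s : S) (a : A) : ℝ :=
  ∑ s', M.P s a s' * V s'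

/-- The transition matrix of the Markov chain of states induced by a stationary policy. -/
def chain (M : CMDP S A) (π : StationaryPolicy S A) : Matrix S S ℝ :=
  Matrix.of fun s s' => ∑ a, π.prob s a * M.P s a s'

/-- The probability that the `n`-th state after `s` is `s'`, under the policy `π`. -/
def stepProb (M : CMDP S A) (π : StationaryPolicy S A) (n : ℕ) (s s' : S) : ℝ :=
  (M.chain π ^ n) s s'

/-- `s'` is accessible from `s` in the chain induced by `π`. -/
def Accessible (M : CMDP S A) (π : StationaryPolicy S A) (s s' : S) : Prop :=
  ∃ n : ℕ, 0 < M.stepProb π n s s'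

/-- No state outside `C` is accessible from a state in `C`. -/
def IsClosedClass (M : CMDP S A) (π : StationaryPolicy S A) (C : Set S) : Prop :=
  ∀ s ∈ C, ∀ s', M.Accessible π s s' → s' ∈ C

/-- `C` is a nonempty closed set without a proper nonempty closed subset. -/
def IsClosedIrreducible (M : CMDP S A) (π : StationaryPolicy S A) (C : Set S) : Prop :=
  C.Nonempty ∧ M.IsClosedClass π C ∧
    ∀ D : Set S, D ⊆ C → D.Nonempty → M.IsClosedClass π D → D = C

/-- The probability that the chain induced by `π`, started at `x`, visits `s` at one of the
times `1, …, n` (the start is time `0`). -/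
def visitWithin (M : CMDP S A) (π : StationaryPolicy S A) (s : S) : ℕ → S → ℝ
  | 0, _ => 0
  | n + 1, x => ∑ y, M.chain π x y * (if y = s then 1 else visitWithin M π s n y)

/-- `s` is transient: the probability of ever returning to `s` from `s`, which is the supremum
of the probabilities of returning within `n` steps, is less than `1`. -/
def IsTransient (M : CMDP S A) (π : StationaryPolicy S A) (s : S) : Prop :=
  (⨆ n : ℕ, M.visitWithin π s n s) < 1

/-- Weakly communicating: some stationary policy induces a chain consisting of a single closed
irreducible class and of states that are transient under all stationary policies. -/
def WeaklyCommunicating (M : CMDP S A) : Prop :=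
  ∃ (π : StationaryPolicy S A) (C : Set S), M.IsClosedIrreducible π C ∧
    ∀ s ∉ C, ∀ π' : StationaryPolicy S A, M.IsTransient π' s

/-- `E_π[∑_{t=1}^T f(s_t, a_t) | s_1 = s]`; the summation index below is `t - 1`. -/
noncomputable def expectedTotal (M : CMDP S A) (π : StationaryPolicy S A) (f : S → A → ℝ)
    (s : S) (T : ℕ) : ℝ :=
  ∑ t ∈ Finset.range T, ∑ x, ∑ a, M.stepProb π t s x * π.prob x a * f x a

/-- The gain `J_f^π(s) = lim_{T → ∞} (1/T) E_π[∑_{t=1}^T f(s_t, a_t) | s_1 = s]`. The limit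
exists for every stationary policy because the state and action spaces are finite. -/
noncomputable def gain (M : CMDP S A) (π : StationaryPolicy S A) (f : S → A → ℝ) (s : S) : ℝ :=
  limUnder atTop fun T : ℕ => (1 / (T : ℝ)) * M.expectedTotal π f s T

/-- Feasibility of the problem `sup_π J_r^π(s₁)` subject to `J_g^π(s₁) ≥ b`. -/
def Feasible (M : CMDP S A) (s₁ : S) : Prop :=
  ∃ π : StationaryPolicy S A, M.b ≤ M.gain π M.g s₁

/-- `J_r^*(s₁)`: the supremum of `J_r^π(s₁)` over stationary `π` with `J_g^π(s₁) ≥ b`. -/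
noncomputable def optimalValue (M : CMDP S A) (s₁ : S) : ℝ :=
  sSup {x : ℝ | ∃ π : StationaryPolicy S A, M.b ≤ M.gain π M.g s₁ ∧ x = M.gain π M.r s₁}

/-- The Lagrangian `L(π, λ) = J_r^π(s₁) + λ (J_g^π(s₁) - b)`. -/
noncomputable def lagrangian (M : CMDP S A) (s₁ : S) (π : StationaryPolicy S A) (lam : ℝ) : ℝ :=
  M.gain π M.r s₁ + lam * (M.gain π M.g s₁ - M.b)

/-- The dual function `D(λ) = sup_π L(π, λ)`, over stationary policies. -/
noncomputable def dual (M : CMDP S A) (s₁ : S) (lam : ℝ) : ℝ :=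
  ⨆ π : StationaryPolicy S A, M.lagrangian s₁ π lam

/-- `lam` minimizes the dual function over `[0, ∞)`. -/
def IsOptimalDual (M : CMDP S A) (s₁ : S) (lam : ℝ) : Prop :=
  0 ≤ lam ∧ ∀ l : ℝ, 0 ≤ l → M.dual s₁ lam ≤ M.dual s₁ l

/-- The optimal gain from `s₁` of the unconstrained MDP with reward `r + λ (g - b)`. -/
noncomputable def optimalGain (M : CMDP S A) (s₁ : S) (lam : ℝ) : ℝ :=
  ⨆ π : StationaryPolicy S A, M.gain π (fun s a => M.r s a + lam * (M.g s a - M.b)) s₁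

/-- `v` satisfies the Bellman optimality inequality of the unconstrained MDP with reward
`r + λ (g - b)`, with the optimal gain of that MDP. -/
def BellmanInequality (M : CMDP S A) (s₁ : S) (lam : ℝ) (v : S → ℝ) : Prop :=
  ∀ s a, M.optimalGain s₁ lam - M.r s a ≥ -lam * (M.b - M.g s a) + M.applyP v s a - v s

/-- `sp(v) = max v - min v`. -/
noncomputable def span (v : S → ℝ) : ℝ := (⨆ s, v s) - ⨅ s, v s

/-- The random states `s 1, …, s (T+1)` and actions `a 1, …, a T` on the probability space
`(Ω, μ)` are the interaction of a learning agent with the CMDP, started at `s₁`: the next state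
has, conditionally on the past states and actions, the law `P(· | s_t, a_t)`. The agent is
unrestricted: `a t` may depend in any way on the past and on additional randomization. -/
structure IsInteraction (M : CMDP S A) (s₁ : S) (T : ℕ) {Ω : Type*} [MeasurableSpace Ω]
    (μ : Measure Ω) (s : ℕ → Ω → S) (a : ℕ → Ω → A) : Prop where
  measurable_state : ∀ t ∈ Finset.Icc 1 (T + 1), ∀ x, MeasurableSet {ω | s t ω = x}
  measurable_action : ∀ t ∈ Finset.Icc 1 T, ∀ y, MeasurableSet {ω | a t ω = y}
  initial : ∀ᵐ ω ∂μ, s 1 ω = s₁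
  transition : ∀ t ∈ Finset.Icc 1 T, ∀ (x : ℕ → S) (y : ℕ → A) (x' : S),
    μ.real {ω | (∀ i ∈ Finset.Icc 1 t, s i ω = x i ∧ a i ω = y i) ∧ s (t + 1) ω = x'} =
      μ.real {ω | ∀ i ∈ Finset.Icc 1 t, s i ω = x i ∧ a i ω = y i} * M.P (x t) (y t) x'

/-- `Regret(T) = ∑_{t=1}^T (J_r^*(s₁) - r(s_t, a_t))` along a trajectory. -/
noncomputable def regret (M : CMDP S A) (s₁ : S) (T : ℕ) (s : ℕ → S) (a : ℕ → A) : ℝ :=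
  ∑ t ∈ Finset.Icc 1 T, (M.optimalValue s₁ - M.r (s t) (a t))

/-- `Violation(T) = ∑_{t=1}^T (b - g(s_t, a_t))` along a trajectory. -/
def violation (M : CMDP S A) (T : ℕ) (s : ℕ → S) (a : ℕ → A) : ℝ :=
  ∑ t ∈ Finset.Icc 1 T, (M.b - M.g (s t) (a t))

end CMDP

/-! The Bellman inequality, summed along the trajectory, telescopes in `v`: apart from a boundary
term of size at most `span v`, what remains is a martingale whose increments `(P v)(s_t, a_t) -
v(s_{t+1})` are bounded by `span v`. Azuma–Hoeffding controls its lower tail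
(`measureReal_noise_lt_le`). This bounds the regret measured against the gain `optimalGain` of the
Lagrangian reward; replacing that gain by the constrained optimum `optimalValue` needs strong
duality.

Existence of `v` is the average-reward optimality equation. Weak communication bounds the span of
the discounted optimal values uniformly in the discount (`exists_span_bound`), so the normalized
values have a limit point as the discount tends to 1 (`exists_optimality_equation`). The optimal
gain is therefore constant and attained by a deterministic policy.

Since deterministic policies are finite in number, the dual function is a finite maximum of affine
functions, whose slopes are the constraint slacks `J_g - b`; feasibility bounds it below on the
half-line, so a minimizer exists. At a positive minimizer there are active policies with slack of
either sign, and complementary slackness suggests mixing them so that the slack vanishes. A mixture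
of gains need not be the gain of one stationary policy, because the mixed policy can have several
recurrent classes. Adding weight `ε` on the communicating policy repairs this: its occupation
measure charges all its moves inside the closed class, so the policy read off from the mixed measure
has constant gains (`exists_policy_gain_eq`). Letting `ε` tend to 0 gives `dual_le_optimalValue`. -/

open scoped Topology Matrix

set_option linter.unusedSectionVars false

/-! ### Finite stochastic matrices: Poisson equation, harmonic functions, hitting bounds. -/

section Stochastic

variable {S : Type*} [Fintype S] [DecidableEq S] {Q : Matrix S S ℝ}

theorem Matrix.mulVec_mono_of_mem_rowStochastic (hQ : Q ∈ Matrix.rowStochastic ℝ S)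
    {u w : S → ℝ} (h : ∀ x, u x ≤ w x) (s : S) : (Q *ᵥ u) s ≤ (Q *ᵥ w) s :=
  Finset.sum_le_sum fun x _ => mul_le_mul_of_nonneg_left (h x) (hQ.1 s x)

theorem Matrix.mulVec_const_of_mem_rowStochastic (hQ : Q ∈ Matrix.rowStochastic ℝ S)
    (c : ℝ) (s : S) : (Q *ᵥ fun _ => c) s = c := by
  simp only [Matrix.mulVec, dotProduct, ← Finset.sum_mul,
    Matrix.sum_row_of_mem_rowStochastic hQ, one_mul]

theorem Matrix.abs_mulVec_le_of_mem_rowStochastic (hQ : Q ∈ Matrix.rowStochastic ℝ S)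
    {u : S → ℝ} {c : ℝ} (h : ∀ x, |u x| ≤ c) (s : S) : |(Q *ᵥ u) s| ≤ c := by
  rw [abs_le]
  constructor
  · rw [← Matrix.mulVec_const_of_mem_rowStochastic hQ (-c) s]
    exact Matrix.mulVec_mono_of_mem_rowStochastic hQ (fun x => (abs_le.1 (h x)).1) s
  · rw [← Matrix.mulVec_const_of_mem_rowStochastic hQ c s]
    exact Matrix.mulVec_mono_of_mem_rowStochastic hQ (fun x => (abs_le.1 (h x)).2) s

theorem Matrix.pow_mulVec_eq_self {y : S → ℝ} (hy : Q *ᵥ y = y) (n : ℕ) :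
    (Q ^ n) *ᵥ y = y := by
  induction n with
  | zero => simp
  | succ n ih => rw [pow_succ, ← Matrix.mulVec_mulVec, hy, ih]

/-- Telescoping of the ergodic sums of `y + (Q z - z)` with `y` invariant. -/
theorem Matrix.sum_pow_mulVec_poisson {y z F : S → ℝ} (hy : Q *ᵥ y = y)
    (hF : F = y + (Q *ᵥ z - z)) (s : S) (T : ℕ) :
    ∑ t ∈ Finset.range T, ((Q ^ t) *ᵥ F) s = T * y s + (((Q ^ T) *ᵥ z) s - z s) := by
  induction T with
  | zero => simp
  | succ n ih =>
    rw [Finset.sum_range_succ, ih, hF, Matrix.mulVec_add, Matrix.mulVec_sub,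
      Matrix.mulVec_mulVec, ← pow_succ, Matrix.pow_mulVec_eq_self hy]
    simp only [Pi.add_apply, Pi.sub_apply]
    push_cast
    ring

/-- The coboundary `Q z - z` telescopes to a bounded quantity, which division by `T` removes. -/
theorem Matrix.tendsto_average_of_poisson (hQ : Q ∈ Matrix.rowStochastic ℝ S)
    {y z F : S → ℝ} (hy : Q *ᵥ y = y) (hF : F = y + (Q *ᵥ z - z)) (s : S) :
    Tendsto (fun T : ℕ => (1 / (T : ℝ)) * ∑ t ∈ Finset.range T, ((Q ^ t) *ᵥ F) s)
      atTop (𝓝 (y s)) := by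
  have hz : ∀ x, |z x| ≤ ‖z‖ := fun x => norm_le_pi_norm z x
  have hlim : Tendsto (fun T : ℕ => (1 / (T : ℝ)) * (((Q ^ T) *ᵥ z) s - z s)) atTop (𝓝 0) := by
    refine squeeze_zero_norm (a := fun T : ℕ => (2 * ‖z‖) * (1 / (T : ℝ))) (fun T => ?_) ?_
    · rw [Real.norm_eq_abs, abs_mul, abs_of_nonneg (by positivity : (0 : ℝ) ≤ 1 / (T : ℝ)),
        mul_comm]
      refine mul_le_mul_of_nonneg_right ?_ (by positivity)
      have h1 := Matrix.abs_mulVec_le_of_mem_rowStochastic (pow_mem hQ T) hz s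
      have h2 := hz s
      rw [abs_le] at *
      constructor <;> linarith
    · simpa using (tendsto_one_div_atTop_nhds_zero_nat (𝕜 := ℝ)).const_mul (2 * ‖z‖)
  have h2 : Tendsto (fun T : ℕ => y s + (1 / (T : ℝ)) * (((Q ^ T) *ᵥ z) s - z s))
      atTop (𝓝 (y s)) := by simpa using hlim.const_add (y s)
  refine h2.congr' ?_
  filter_upwards [eventually_gt_atTop 0] with T hT
  rw [Matrix.sum_pow_mulVec_poisson hy hF]
  have : (T : ℝ) ≠ 0 := by positivity
  field_simp

/-- Solvability of the Poisson equation of a finite Markov chain. -/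
theorem Matrix.exists_poisson (hQ : Q ∈ Matrix.rowStochastic ℝ S) (F : S → ℝ) :
    ∃ y z : S → ℝ, Q *ᵥ y = y ∧ F = y + (Q *ᵥ z - z) := by
  set L : (S → ℝ) →ₗ[ℝ] (S → ℝ) := Q.mulVecLin - LinearMap.id with hL
  have hLa : ∀ z, L z = Q *ᵥ z - z := fun z => by simp [hL]
  -- An invariant vector of the form `L z` has two Poisson decompositions: its Cesàro averages tend
  -- to itself and also to 0. Trivial intersection and rank–nullity then split the whole space.
  have hdisj : Disjoint (LinearMap.ker L) (LinearMap.range L) := by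
    rw [Submodule.disjoint_def]
    rintro x hx ⟨z, rfl⟩
    rw [LinearMap.mem_ker, hLa] at hx
    have hy : Q *ᵥ (L z) = L z := sub_eq_zero.1 hx
    funext s
    have h1 := Matrix.tendsto_average_of_poisson hQ hy (F := L z) (z := 0) (by simp) s
    have h2 := Matrix.tendsto_average_of_poisson hQ (y := 0) (F := L z) (z := z) (by simp)
      (by simp [hLa]) s
    exact tendsto_nhds_unique h1 h2
  have hc : IsCompl (LinearMap.ker L) (LinearMap.range L) :=
    (Submodule.isCompl_iff_disjoint _ _ (by
      have := LinearMap.finrank_range_add_finrank_ker L; omega)).2 hdisj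
  have hF : F ∈ LinearMap.ker L ⊔ LinearMap.range L := by rw [hc.sup_eq_top]; trivial
  obtain ⟨y, hy, w, ⟨z, rfl⟩, h⟩ := Submodule.mem_sup.1 hF
  rw [LinearMap.mem_ker, hLa] at hy
  exact ⟨y, z, sub_eq_zero.1 hy, by rw [← h, hLa]⟩

/-- A harmonic function attains its value at every maximum at each accessible state. -/
theorem Matrix.harmonic_le_of_accessible (hQ : Q ∈ Matrix.rowStochastic ℝ S) {h : S → ℝ}
    (hh : Q *ᵥ h = h) {z : S} (hz : ∀ x, ∃ n : ℕ, 0 < (Q ^ n) x z) (s : S) : h s ≤ h z := by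
  obtain ⟨m, -, hm⟩ := Finset.exists_max_image Finset.univ h ⟨s, Finset.mem_univ s⟩
  obtain ⟨n, hn⟩ := hz m
  have h1 : ∑ x, (Q ^ n) m x * (h m - h x) = 0 := by
    have h2 := congrFun (Matrix.pow_mulVec_eq_self hh n) m
    have h3 := Matrix.mulVec_const_of_mem_rowStochastic (pow_mem hQ n) (h m) m
    simp only [Matrix.mulVec, dotProduct] at h2 h3
    simp only [mul_sub, Finset.sum_sub_distrib, h2, h3, sub_self]
  have h4 := (Finset.sum_eq_zero_iff_of_nonneg (fun x _ =>
    mul_nonneg ((pow_mem hQ n).1 m x) (sub_nonneg.2 (hm x (Finset.mem_univ x))))).1 h1 z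
    (Finset.mem_univ z)
  have h5 : h m = h z := by
    rcases mul_eq_zero.1 h4 with h | h
    · exact absurd h hn.ne'
    · linarith
  exact h5 ▸ hm s (Finset.mem_univ s)

theorem Matrix.harmonic_eq_of_accessible (hQ : Q ∈ Matrix.rowStochastic ℝ S) {h : S → ℝ}
    (hh : Q *ᵥ h = h) {z : S} (hz : ∀ x, ∃ n : ℕ, 0 < (Q ^ n) x z) (s : S) : h s = h z := by
  refine le_antisymm (Matrix.harmonic_le_of_accessible hQ hh hz s) ?_
  have := Matrix.harmonic_le_of_accessible hQ (h := -h) (by rw [Matrix.mulVec_neg, hh]) hz s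
  simpa using this

/-- If every state has access to `Z`, then subsolutions of `u ≤ c + Q u` vanishing on `Z` are
bounded by a multiple of `c` that depends on the chain only. -/
theorem Matrix.exists_hitting_bound (hQ : Q ∈ Matrix.rowStochastic ℝ S) {Z : Set S}
    (hZ : ∀ x, ∃ y ∈ Z, ∃ n : ℕ, 0 < (Q ^ n) x y) :
    ∃ K : ℝ, 0 ≤ K ∧ ∀ (u : S → ℝ) (c : ℝ), 0 ≤ c → (∀ s, 0 ≤ u s) →
      (∀ s, u s ≤ c + (Q *ᵥ u) s) → (∀ y ∈ Z, u y = 0) → ∀ s, u s ≤ K * c := by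
  choose y hyZ n hn using hZ
  -- At a maximizer `m` of `u`, iterating `n m` times gives `u m ≤ n c + (1 - p) u m`, where `p` is
  -- the probability of being at `y m ∈ Z` then; hence `u m ≤ (n / p) c`. Summing over all states
  -- makes the constant independent of `m`.
  refine ⟨∑ s, n s / (Q ^ n s) s (y s), Finset.sum_nonneg fun s _ => by
    have := hn s; positivity, fun u c hc hu hle hzero s => ?_⟩
  have iter : ∀ (k : ℕ) (x : S), u x ≤ k * c + ((Q ^ k) *ᵥ u) x := by
    intro k
    induction k with
    | zero => intro x; simp
    | succ k ih =>
      intro x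
      have h1 := Matrix.mulVec_mono_of_mem_rowStochastic (pow_mem hQ k)
        (w := (fun _ => c) + Q *ᵥ u) hle x
      rw [Matrix.mulVec_add, Matrix.mulVec_mulVec, ← pow_succ, Pi.add_apply,
        Matrix.mulVec_const_of_mem_rowStochastic (pow_mem hQ k)] at h1
      have := ih x
      push_cast
      linarith
  obtain ⟨m, -, hm⟩ := Finset.exists_max_image Finset.univ u ⟨s, Finset.mem_univ s⟩
  have hp := hn m
  have h1 : ((Q ^ n m) *ᵥ u) m ≤ u m - (Q ^ n m) m (y m) * u m := by
    have h2 := Matrix.mulVec_mono_of_mem_rowStochastic (pow_mem hQ (n m)) (u := u)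
      (w := fun x => u m - Pi.single (M := fun _ => ℝ) (y m) (u m) x) (fun x => by
        by_cases hx : x = y m
        · subst hx; simp [hzero _ (hyZ m)]
        · simpa [hx] using hm x (Finset.mem_univ x)) m
    have h3 : (Q ^ n m) *ᵥ (fun x => u m - Pi.single (M := fun _ => ℝ) (y m) (u m) x) =
      (Q ^ n m) *ᵥ (fun _ => u m) - (Q ^ n m) *ᵥ Pi.single (M := fun _ => ℝ) (y m) (u m) := by
      rw [← Matrix.mulVec_sub]; rfl
    rw [h3, Pi.sub_apply, Matrix.mulVec_const_of_mem_rowStochastic (pow_mem hQ _)] at h2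
    simpa [Matrix.mulVec_single] using h2
  have h4 := iter (n m) m
  have h5 : u m ≤ n m / (Q ^ n m) m (y m) * c := by
    rw [div_mul_eq_mul_div, le_div_iff₀ hp]
    linarith
  calc u s ≤ u m := hm s (Finset.mem_univ s)
    _ ≤ n m / (Q ^ n m) m (y m) * c := h5
    _ ≤ _ := mul_le_mul_of_nonneg_right (Finset.single_le_sum
      (f := fun s => (n s : ℝ) / (Q ^ n s) s (y s)) (fun s _ => by
        have := hn s; positivity) (Finset.mem_univ m)) hc

end Stochastic

/-! ### Averages over the actions of a stationary policy. -/

namespace StationaryPolicy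

variable {S A : Type*} [Fintype A]

/-- The expectation of `f s a` over the action that the policy takes in `s`. -/
def avg (π : StationaryPolicy S A) (f : S → A → ℝ) (s : S) : ℝ :=
  ∑ a, π.prob s a * f s a

theorem avg_mono (π : StationaryPolicy S A) {f f' : S → A → ℝ} (h : ∀ s a, f s a ≤ f' s a)
    (s : S) : π.avg f s ≤ π.avg f' s :=
  Finset.sum_le_sum fun a _ => mul_le_mul_of_nonneg_left (h s a) (π.prob_nonneg s a)

theorem avg_of_state (π : StationaryPolicy S A) (V : S → ℝ) :
    π.avg (fun s _ => V s) = V := by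
  funext s
  simp only [avg, ← Finset.sum_mul, π.prob_sum, one_mul]

open Classical in
/-- The policy that takes the action `φ s` in `s`. -/
noncomputable def deterministic (φ : S → A) : StationaryPolicy S A where
  prob s a := if a = φ s then 1 else 0
  prob_nonneg s a := by split_ifs <;> norm_num
  prob_sum s := by simp

theorem avg_deterministic (φ : S → A) (f : S → A → ℝ) (s : S) :
    (deterministic φ).avg f s = f s (φ s) := by
  rw [avg, Finset.sum_eq_single (φ s)]
  · simp [deterministic]
  · intro a _ ha; simp [deterministic, ha]
  · simp

end StationaryPolicy

/-! ### Gains of stationary policies and their occupation measures. -/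

namespace CMDP

variable {S A : Type*} [Fintype S] [DecidableEq S] [Fintype A] (M : CMDP S A)
  (π : StationaryPolicy S A)

theorem chain_mem : M.chain π ∈ Matrix.rowStochastic ℝ S := by
  rw [Matrix.mem_rowStochastic_iff_sum]
  refine ⟨fun s s' => Finset.sum_nonneg fun a _ =>
    mul_nonneg (π.prob_nonneg s a) (M.P_nonneg s a s'), fun s => ?_⟩
  simp only [chain, Matrix.of_apply]
  rw [Finset.sum_comm]
  simp only [← Finset.mul_sum, M.P_sum, mul_one, π.prob_sum]

theorem chain_mulVec (V : S → ℝ) : M.chain π *ᵥ V = π.avg (M.applyP V) := by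
  funext s
  simp only [chain, Matrix.mulVec, dotProduct, Matrix.of_apply, StationaryPolicy.avg, applyP,
    Finset.sum_mul, Finset.mul_sum]
  rw [Finset.sum_comm]
  simp only [mul_assoc]

theorem expectedTotal_eq (f : S → A → ℝ) (s : S) (T : ℕ) :
    M.expectedTotal π f s T = ∑ t ∈ Finset.range T, ((M.chain π ^ t) *ᵥ π.avg f) s := by
  simp only [expectedTotal, stepProb, Matrix.mulVec, dotProduct, StationaryPolicy.avg,
    Finset.mul_sum, mul_assoc]

theorem gain_eq_of_poisson {f : S → A → ℝ} {y z : S → ℝ} (hy : M.chain π *ᵥ y = y)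
    (hF : π.avg f = y + (M.chain π *ᵥ z - z)) : M.gain π f = y := by
  funext s
  refine Tendsto.limUnder_eq ?_
  simp only [expectedTotal_eq]
  exact Matrix.tendsto_average_of_poisson (M.chain_mem π) hy hF s

/-- The gain and the bias of a stationary policy solve the Poisson equation. -/
theorem gain_poisson (f : S → A → ℝ) : M.chain π *ᵥ M.gain π f = M.gain π f ∧
    ∃ z, π.avg f = M.gain π f + (M.chain π *ᵥ z - z) := by
  obtain ⟨y, z, hy, hF⟩ := Matrix.exists_poisson (M.chain_mem π) (π.avg f)
  have h := M.gain_eq_of_poisson π hy hF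
  rw [h]
  exact ⟨hy, z, hF⟩

/-- The limit in the definition of `gain` exists, so `limUnder` never returns a default value. -/
theorem tendsto_gain (f : S → A → ℝ) (s : S) :
    Tendsto (fun T : ℕ => (1 / (T : ℝ)) * M.expectedTotal π f s T) atTop (𝓝 (M.gain π f s)) := by
  obtain ⟨hy, z, hz⟩ := M.gain_poisson π f
  simp only [expectedTotal_eq]
  exact Matrix.tendsto_average_of_poisson (M.chain_mem π) hy hz s

theorem gain_add (f f' : S → A → ℝ) (s : S) :
    M.gain π (fun s a => f s a + f' s a) s = M.gain π f s + M.gain π f' s := by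
  refine tendsto_nhds_unique (M.tendsto_gain π _ s)
    (((M.tendsto_gain π f s).add (M.tendsto_gain π f' s)).congr fun T => ?_)
  simp only [expectedTotal, ← mul_add, ← Finset.sum_add_distrib]

theorem gain_const_mul (c : ℝ) (f : S → A → ℝ) (s : S) :
    M.gain π (fun s a => c * f s a) s = c * M.gain π f s := by
  refine tendsto_nhds_unique (M.tendsto_gain π _ s)
    (((M.tendsto_gain π f s).const_mul c).congr fun T => ?_)
  simp only [expectedTotal, Finset.mul_sum]
  refine Finset.sum_congr rfl fun _ _ => Finset.sum_congr rfl fun _ _ =>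
    Finset.sum_congr rfl fun _ _ => by ring

theorem gain_const (c : ℝ) (s : S) : M.gain π (fun _ _ => c) s = c := by
  have h := M.gain_eq_of_poisson π (f := fun _ _ => c) (y := fun _ => c) (z := 0)
    (funext fun s => Matrix.mulVec_const_of_mem_rowStochastic (M.chain_mem π) c s)
    (by rw [π.avg_of_state (fun _ => c)]; simp)
  exact congrFun h s

theorem gain_sum {ι : Type*} (I : Finset ι) (f : ι → S → A → ℝ) (s : S) :
    M.gain π (fun s a => ∑ i ∈ I, f i s a) s = ∑ i ∈ I, M.gain π (f i) s := by
  classical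
  induction I using Finset.induction_on with
  | empty => simpa using M.gain_const π 0 s
  | insert i I hi ih =>
    simp only [Finset.sum_insert hi]
    rw [M.gain_add π (f i) (fun s a => ∑ i ∈ I, f i s a), ih]

theorem gain_mono {f f' : S → A → ℝ} (h : ∀ s, π.avg f s ≤ π.avg f' s) (s : S) :
    M.gain π f s ≤ M.gain π f' s := by
  refine le_of_tendsto_of_tendsto' (M.tendsto_gain π f s) (M.tendsto_gain π f' s) fun T => ?_
  simp only [expectedTotal_eq]
  exact mul_le_mul_of_nonneg_left (Finset.sum_le_sum fun t _ =>
    Matrix.mulVec_mono_of_mem_rowStochastic (pow_mem (M.chain_mem π) t) h s) (by positivity)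

/-- Shifting time by one step does not change a Cesàro limit; in Poisson form, the bias `z` is
replaced by its image under the chain. -/
theorem gain_applyP (V : S → ℝ) : M.gain π (M.applyP V) = M.gain π fun s _ => V s := by
  obtain ⟨hy, z, hz⟩ := M.gain_poisson π fun s _ => V s
  refine M.gain_eq_of_poisson π (z := M.chain π *ᵥ z) hy ?_
  rw [π.avg_of_state] at hz
  rw [← chain_mulVec]
  conv_lhs => rw [hz]
  rw [Matrix.mulVec_add, Matrix.mulVec_sub, hy]

/-- A subsolution of the policy evaluation equation bounds the gain from above. -/
theorem gain_le_of_avg {f : S → A → ℝ} {ρ : ℝ} {h : S → ℝ}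
    (hb : ∀ s, π.avg (fun s a => f s a + M.applyP h s a) s ≤ ρ + h s) (s : S) :
    M.gain π f s ≤ ρ := by
  have h1 := M.gain_mono π (f := fun s a => f s a + M.applyP h s a)
    (f' := fun s _ => ρ + h s) (fun s => by
      rw [π.avg_of_state (fun s => ρ + h s)]; exact hb s) s
  rw [M.gain_add π f (M.applyP h), M.gain_add π (fun _ _ => ρ) (fun s _ => h s), gain_applyP,
    gain_const] at h1
  linarith

theorem le_gain_of_avg {f : S → A → ℝ} {ρ : ℝ} {h : S → ℝ}
    (hb : ∀ s, ρ + h s ≤ π.avg (fun s a => f s a + M.applyP h s a) s) (s : S) :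
    ρ ≤ M.gain π f s := by
  have h1 := M.gain_mono π (f' := fun s a => f s a + M.applyP h s a)
    (f := fun s _ => ρ + h s) (fun s => by
      rw [π.avg_of_state (fun s => ρ + h s)]; exact hb s) s
  rw [M.gain_add π f (M.applyP h), M.gain_add π (fun _ _ => ρ) (fun s _ => h s), gain_applyP,
    gain_const] at h1
  linarith

theorem gain_nonneg {f : S → A → ℝ} (hf : ∀ s a, 0 ≤ f s a) (s : S) : 0 ≤ M.gain π f s := by
  rw [← M.gain_const π 0 s]
  exact M.gain_mono π (π.avg_mono hf) s

/-! ### Occupation measures -/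

open Classical in
/-- The long-run frequency of the pair `(x, a)` when `π` is run from `s`. -/
noncomputable def occupation (s x : S) (a : A) : ℝ :=
  M.gain π (fun y c => if y = x ∧ c = a then 1 else 0) s

theorem occupation_nonneg (s x : S) (a : A) : 0 ≤ M.occupation π s x a :=
  M.gain_nonneg π (fun _ _ => by split_ifs <;> norm_num) s

/-- The gain is linear in `f`, and `f` is a combination of indicators of state-action pairs. -/
theorem gain_eq_sum_occupation (f : S → A → ℝ) (s : S) :
    M.gain π f s = ∑ x, ∑ a, M.occupation π s x a * f x a := by
  classical
  have h : f = fun y c => ∑ x, ∑ a, f x a * (if y = x ∧ c = a then 1 else 0) := by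
    funext y c
    rw [Finset.sum_eq_single y, Finset.sum_eq_single c]
    · simp
    · intro b _ hb; simp [hb.symm]
    · simp
    · intro b _ hb; simp [hb.symm]
    · simp
  conv_lhs => rw [h]
  rw [M.gain_sum π Finset.univ (fun x y c => ∑ a, f x a * (if y = x ∧ c = a then 1 else 0))]
  refine Finset.sum_congr rfl fun x _ => ?_
  rw [M.gain_sum π Finset.univ (fun a y c => f x a * (if y = x ∧ c = a then 1 else 0))]
  refine Finset.sum_congr rfl fun a _ => ?_
  rw [M.gain_const_mul π, mul_comm]
  unfold occupation
  congr!

theorem sum_occupation_mul_applyP (V : S → ℝ) (s : S) :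
    ∑ x, ∑ a, M.occupation π s x a * M.applyP V x a =
      ∑ x, (∑ a, M.occupation π s x a) * V x := by
  rw [← gain_eq_sum_occupation, gain_applyP, gain_eq_sum_occupation]
  simp only [Finset.sum_mul]

theorem sum_occupation (s : S) : ∑ x, ∑ a, M.occupation π s x a = 1 := by
  have h := M.gain_eq_sum_occupation π (fun _ _ => 1) s
  rw [gain_const] at h
  simpa using h.symm

theorem gain_eq_of_avg_eq {f f' : S → A → ℝ} (h : π.avg f = π.avg f') (s : S) :
    M.gain π f s = M.gain π f' s :=
  le_antisymm (M.gain_mono π (fun s => (congrFun h s).le) s)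
    (M.gain_mono π (fun s => (congrFun h s).ge) s)

/-- Actions are taken with the frequencies prescribed by the policy. -/
theorem occupation_eq (s x : S) (a : A) :
    M.occupation π s x a = (∑ c, M.occupation π s x c) * π.prob x a := by
  classical
  have h1 : ∑ c, M.occupation π s x c = M.gain π (fun y _ => if y = x then 1 else 0) s := by
    rw [gain_eq_sum_occupation, Finset.sum_eq_single x]
    · simp
    · intro b _ hb; simp [hb]
    · simp
  rw [h1, mul_comm, ← gain_const_mul]
  unfold occupation
  refine M.gain_eq_of_avg_eq π (funext fun y => ?_) s
  by_cases hy : y = x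
  · subst hy
    simp [StationaryPolicy.avg, ← Finset.sum_mul, π.prob_sum]
  · simp [StationaryPolicy.avg, hy]

/-- Stationarity of the state frequencies. -/
theorem sum_occupation_mul_chain (V : S → ℝ) (s : S) :
    ∑ x, (∑ a, M.occupation π s x a) * (M.chain π *ᵥ V) x =
      ∑ x, (∑ a, M.occupation π s x a) * V x := by
  rw [← M.sum_occupation_mul_applyP π V s]
  refine Finset.sum_congr rfl fun x _ => ?_
  rw [chain_mulVec, StationaryPolicy.avg, Finset.mul_sum]
  refine Finset.sum_congr rfl fun a _ => ?_
  rw [← mul_assoc, ← occupation_eq]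

theorem accessible_of_occupation_pos {s x : S} (h : 0 < ∑ a, M.occupation π s x a) :
    M.Accessible π s x := by
  classical
  by_contra hn
  have h0 : ∀ n, (M.chain π ^ n) s x = 0 := fun n =>
    le_antisymm (not_lt.1 fun h => hn ⟨n, h⟩) ((pow_mem (M.chain_mem π) n).1 s x)
  refine h.ne' (Finset.sum_eq_zero fun a _ => ?_)
  refine tendsto_nhds_unique (M.tendsto_gain π _ s) (tendsto_const_nhds.congr fun T => ?_)
  simp only [expectedTotal, stepProb]
  rw [Finset.sum_eq_zero, mul_zero]
  refine fun t _ => Finset.sum_eq_zero fun y _ => Finset.sum_eq_zero fun c _ => ?_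
  by_cases hy : y = x
  · rw [hy, h0]; simp
  · simp [hy]

end CMDP

/-! ### Transience, accessibility and the support of the occupation measure. -/

namespace CMDP

variable {S A : Type*} [Fintype S] [DecidableEq S] [Fintype A] (M : CMDP S A)
  (π : StationaryPolicy S A)

theorem visitWithin_succ (y : S) (n : ℕ) (x : S) : M.visitWithin π y (n + 1) x =
    (M.chain π *ᵥ fun z => if z = y then 1 else M.visitWithin π y n z) x := rfl

theorem visitWithin_le_one (y : S) (n : ℕ) (x : S) : M.visitWithin π y n x ≤ 1 := by
  induction n generalizing x with
  | zero => simp [visitWithin]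
  | succ n ih =>
    rw [visitWithin_succ]
    refine (Matrix.mulVec_mono_of_mem_rowStochastic (M.chain_mem π) (w := fun _ => 1)
      (fun z => ?_) x).trans (Matrix.mulVec_const_of_mem_rowStochastic (M.chain_mem π) 1 x).le
    split_ifs
    · exact le_rfl
    · exact ih z

theorem visitWithin_le_succ (y : S) (n : ℕ) (x : S) :
    M.visitWithin π y n x ≤ M.visitWithin π y (n + 1) x := by
  induction n generalizing x with
  | zero =>
    rw [visitWithin_succ, ← Matrix.mulVec_const_of_mem_rowStochastic (M.chain_mem π)
      (M.visitWithin π y 0 x) x]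
    refine Matrix.mulVec_mono_of_mem_rowStochastic (M.chain_mem π) (fun z => ?_) x
    split_ifs <;> simp [visitWithin]
  | succ n ih =>
    rw [visitWithin_succ, visitWithin_succ]
    refine Matrix.mulVec_mono_of_mem_rowStochastic (M.chain_mem π) (fun z => ?_) x
    split_ifs
    · exact le_rfl
    · exact ih z

theorem tendsto_visitWithin (y x : S) :
    Tendsto (fun n => M.visitWithin π y n x) atTop (𝓝 (⨆ n, M.visitWithin π y n x)) :=
  tendsto_atTop_ciSup (monotone_nat_of_le_succ fun n => M.visitWithin_le_succ π y n x)
    ⟨1, by rintro _ ⟨n, rfl⟩; exact M.visitWithin_le_one π y n x⟩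

/-- First-step analysis of the probability of visiting `y`. -/
theorem iSup_visitWithin_eq (y x : S) : ⨆ n, M.visitWithin π y n x =
    (M.chain π *ᵥ fun z => if z = y then 1 else ⨆ n, M.visitWithin π y n z) x := by
  refine tendsto_nhds_unique ((tendsto_add_atTop_iff_nat 1).2 (M.tendsto_visitWithin π y x)) ?_
  simp only [visitWithin_succ, Matrix.mulVec, dotProduct]
  refine tendsto_finsetSum _ fun z _ => Tendsto.const_mul _ ?_
  split_ifs
  · exact tendsto_const_nhds
  · exact M.tendsto_visitWithin π y z

/-- A state with positive long-run frequency is not transient. -/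
theorem not_isTransient_of_occupation_pos {s y : S} (h : 0 < ∑ a, M.occupation π s y a) :
    ¬ M.IsTransient π y := by
  intro ht
  -- The test function equals 1 at `y` and the visit probability elsewhere; one step of the chain
  -- turns it into the visit probability everywhere. Stationarity cancels all terms but the one at
  -- `y`, so mass times (return probability − 1) is 0.
  have h1 := M.sum_occupation_mul_chain π
    (fun z => if z = y then 1 else ⨆ n, M.visitWithin π y n z) s
  simp only [← iSup_visitWithin_eq] at h1
  rw [← sub_eq_zero, ← Finset.sum_sub_distrib, Finset.sum_eq_single y] at h1
  · rw [if_pos rfl, ← mul_sub] at h1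
    rcases mul_eq_zero.1 h1 with h2 | h2
    · exact h.ne' h2
    · exact ht.ne (sub_eq_zero.1 h2)
  · intro b _ hb
    rw [if_neg hb, sub_self]
  · simp

/-- The frequencies sum to 1, so some state has positive frequency; it is accessible and not
transient, hence lies in `C`. -/
theorem exists_accessible_of_transient {C : Set S}
    (hC : ∀ s ∉ C, ∀ π' : StationaryPolicy S A, M.IsTransient π' s) (x : S) :
    ∃ y ∈ C, M.Accessible π x y := by
  have h1 := M.sum_occupation π x
  obtain ⟨y, -, hy⟩ : ∃ y ∈ Finset.univ, 0 < ∑ a, M.occupation π x y a := by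
    by_contra! hn
    have := Finset.sum_nonpos hn
    linarith
  exact ⟨y, by_contra fun hyC => M.not_isTransient_of_occupation_pos π hy (hC y hyC π),
    M.accessible_of_occupation_pos π hy⟩

variable {M π}

theorem Accessible.refl (x : S) : M.Accessible π x x := ⟨0, by simp [stepProb]⟩

theorem Accessible.trans {x y z : S} (hxy : M.Accessible π x y) (hyz : M.Accessible π y z) :
    M.Accessible π x z := by
  obtain ⟨m, hm⟩ := hxy
  obtain ⟨n, hn⟩ := hyz
  refine ⟨m + n, ?_⟩
  unfold stepProb at *
  rw [pow_add, Matrix.mul_apply]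
  exact lt_of_lt_of_le (mul_pos hm hn) (Finset.single_le_sum
    (f := fun w => (M.chain π ^ m) x w * (M.chain π ^ n) w z)
    (fun w _ => mul_nonneg ((pow_mem (M.chain_mem π) m).1 x w)
      ((pow_mem (M.chain_mem π) n).1 w z)) (Finset.mem_univ y))

theorem Accessible.of_chain_pos {x y : S} (h : 0 < M.chain π x y) : M.Accessible π x y :=
  ⟨1, by simpa [stepProb] using h⟩

/-- Induction on accessibility along one-step transitions. -/
theorem Accessible.induction {p : S → Prop} {x z : S} (h : M.Accessible π x z) (hx : p x)
    (hstep : ∀ u w, p u → 0 < M.chain π u w → p w) : p z := by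
  obtain ⟨n, hn⟩ := h
  induction n generalizing z with
  | zero =>
    by_cases hxz : x = z
    · exact hxz ▸ hx
    · simp [stepProb, hxz] at hn
  | succ n ih =>
    unfold stepProb at *
    rw [pow_succ, Matrix.mul_apply] at hn
    obtain ⟨w, -, hw⟩ : ∃ w ∈ Finset.univ, 0 < (M.chain π ^ n) x w * M.chain π w z := by
      by_contra! hc
      exact absurd (Finset.sum_nonpos hc) (not_le.2 hn)
    have h1 := (pow_mem (M.chain_mem π) n).1 x w
    have h2 : 0 < (M.chain π ^ n) x w := lt_of_le_of_ne h1 fun h => by simp [← h] at hw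
    exact hstep w z (ih h2) (pos_of_mul_pos_right hw h1)

/-- The states accessible from `x` form a nonempty closed subset of `C`, which by minimality is `C`.
-/
theorem IsClosedIrreducible.accessible {C : Set S} (hC : M.IsClosedIrreducible π C) {x y : S}
    (hx : x ∈ C) (hy : y ∈ C) : M.Accessible π x y := by
  have h : {w | M.Accessible π x w} = C := hC.2.2 _ (fun w hw => hC.2.1 x hx w hw)
    ⟨x, Accessible.refl x⟩ fun s hs s' hs' => Accessible.trans hs hs'
  have : y ∈ {w | M.Accessible π x w} := h ▸ hy
  exact this

theorem IsClosedIrreducible.accessible_of_transient {C : Set S}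
    (hC : M.IsClosedIrreducible π C)
    (ht : ∀ s ∉ C, ∀ π' : StationaryPolicy S A, M.IsTransient π' s) (x : S) {y : S}
    (hy : y ∈ C) : M.Accessible π x y := by
  obtain ⟨w, hw, hxw⟩ := M.exists_accessible_of_transient π ht x
  exact hxw.trans (hC.accessible hw hy)

/-- A stationary measure is positive on every state accessible from its support. -/
theorem occupation_pos_of_accessible {s x y : S} (hx : 0 < ∑ a, M.occupation π s x a)
    (h : M.Accessible π x y) : 0 < ∑ a, M.occupation π s y a := by
  refine h.induction (p := fun y => 0 < ∑ a, M.occupation π s y a) hx fun u w hu huw => ?_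
  have h1 := M.sum_occupation_mul_chain π (Pi.single w 1) s
  have h2 : ∑ x, (∑ a, M.occupation π s x a) * Pi.single (M := fun _ => ℝ) w 1 x =
      ∑ a, M.occupation π s w a := by
    rw [Finset.sum_eq_single w]
    · simp
    · intro b _ hb; simp [hb]
    · simp
  rw [← h2, ← h1]
  refine lt_of_lt_of_le (mul_pos hu huw) ?_
  have h3 := Finset.single_le_sum
    (f := fun x => (∑ a, M.occupation π s x a) * (M.chain π *ᵥ Pi.single w 1) x)
    (fun x _ => mul_nonneg (Finset.sum_nonneg fun a _ => M.occupation_nonneg π s x a) (by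
      simpa using (M.chain_mem π).1 x w)) (Finset.mem_univ u)
  simpa using h3

theorem IsClosedIrreducible.occupation_pos {C : Set S}
    (hC : M.IsClosedIrreducible π C)
    (ht : ∀ s ∉ C, ∀ π' : StationaryPolicy S A, M.IsTransient π' s) (s : S) {y : S}
    (hy : y ∈ C) : 0 < ∑ a, M.occupation π s y a := by
  obtain ⟨x, -, hx⟩ : ∃ x ∈ Finset.univ, 0 < ∑ a, M.occupation π s x a := by
    by_contra! hn
    have := Finset.sum_nonpos hn
    linarith [M.sum_occupation π s]
  exact occupation_pos_of_accessible hx (hC.accessible_of_transient ht x hy)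

end CMDP

/-! ### Discounted values and the average-reward optimality equation. -/

namespace CMDP

variable {S A : Type*} [Fintype S] [DecidableEq S] [Fintype A] (M : CMDP S A)

/-- The Bellman optimality operator with discount factor `β`. -/
noncomputable def bellman [Nonempty A] (f : S → A → ℝ) (β : ℝ) (v : S → ℝ) (s : S) : ℝ :=
  Finset.univ.sup' Finset.univ_nonempty fun a => f s a + β * M.applyP v s a

variable [Nonempty A]

theorem le_bellman (f : S → A → ℝ) (β : ℝ) (v : S → ℝ) (s : S) (a : A) :
    f s a + β * M.applyP v s a ≤ M.bellman f β v s :=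
  Finset.le_sup' (fun a => f s a + β * M.applyP v s a) (Finset.mem_univ a)

theorem exists_greedy (f : S → A → ℝ) (β : ℝ) (v : S → ℝ) :
    ∃ φ : S → A, ∀ s, M.bellman f β v s = f s (φ s) + β * M.applyP v s (φ s) := by
  have h : ∀ s, ∃ a, M.bellman f β v s = f s a + β * M.applyP v s a := fun s => by
    obtain ⟨a, -, ha⟩ := Finset.exists_mem_eq_sup' (Finset.univ_nonempty (α := A))
      (fun a => f s a + β * M.applyP v s a)
    exact ⟨a, ha⟩
  choose φ hφ using h
  exact ⟨φ, hφ⟩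

theorem applyP_sub (v w : S → ℝ) (s : S) (a : A) :
    M.applyP (fun x => v x - w x) s a = M.applyP v s a - M.applyP w s a := by
  simp only [applyP, mul_sub, Finset.sum_sub_distrib]

theorem applyP_const (c : ℝ) (s : S) (a : A) : M.applyP (fun _ => c) s a = c := by
  simp only [applyP, ← Finset.sum_mul, M.P_sum, one_mul]

theorem applyP_mono {v w : S → ℝ} (h : ∀ x, v x ≤ w x) (s : S) (a : A) :
    M.applyP v s a ≤ M.applyP w s a :=
  Finset.sum_le_sum fun x _ => mul_le_mul_of_nonneg_left (h x) (M.P_nonneg s a x)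

theorem bellman_le_add (f : S → A → ℝ) {β : ℝ} (hβ : 0 ≤ β) (v w : S → ℝ) (s : S) :
    M.bellman f β v s ≤ M.bellman f β w s + β * dist v w := by
  refine Finset.sup'_le _ _ fun a _ => ?_
  have h1 : M.applyP v s a - M.applyP w s a ≤ dist v w := by
    rw [← applyP_sub, ← M.applyP_const (dist v w) s a]
    exact M.applyP_mono (fun x => (le_abs_self _).trans (dist_le_pi_dist v w x)) s a
  have h2 := M.le_bellman f β w s a
  nlinarith [mul_le_mul_of_nonneg_left h1 hβ]

theorem exists_discounted_value (f : S → A → ℝ) {β : ℝ} (hβ : 0 ≤ β) (hβ1 : β < 1) :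
    ∃ v : S → ℝ, M.bellman f β v = v := by
  have hc : ContractingWith ⟨β, hβ⟩ (M.bellman f β) := by
    refine ⟨by exact_mod_cast hβ1, LipschitzWith.of_dist_le_mul fun v w => ?_⟩
    rw [dist_pi_le_iff (by positivity)]
    intro s
    have h1 := M.bellman_le_add f hβ v w s
    have h2 := M.bellman_le_add f hβ w v s
    rw [dist_comm w v] at h2
    rw [Real.dist_eq, abs_le]
    change _ ∧ _ ≤ β * dist v w
    change -(β * dist v w) ≤ _ ∧ _
    constructor <;> linarith
  exact ⟨_, hc.fixedPoint_isFixedPt⟩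

/-- At a maximizer of `|v|` the fixed-point equation gives `|v| ≤ F + β |v|`. The bound does not
blow up as `β` tends to 1, so `(1 - β) v` has limit points, which are the candidates for the gain.
-/
theorem abs_discounted_value_le {f : S → A → ℝ} {F : ℝ} (hF : ∀ s a, |f s a| ≤ F) {β : ℝ}
    (hβ : 0 ≤ β) (hβ1 : β < 1) {v : S → ℝ} (hv : M.bellman f β v = v) (s : S) :
    |(1 - β) * v s| ≤ F := by
  obtain ⟨m, -, hm⟩ := Finset.exists_max_image Finset.univ (fun s => |v s|) ⟨s, Finset.mem_univ s⟩
  obtain ⟨φ, hφ⟩ := M.exists_greedy f β v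
  have h1 : |M.applyP v m (φ m)| ≤ |v m| := by
    rw [abs_le]
    constructor
    · rw [← M.applyP_const (-|v m|) m (φ m)]
      exact M.applyP_mono (fun x => (abs_le.1 (hm x (Finset.mem_univ x))).1) _ _
    · conv_rhs => rw [← M.applyP_const |v m| m (φ m)]
      exact M.applyP_mono (fun x => (abs_le.1 (hm x (Finset.mem_univ x))).2) _ _
  have h2 : |v m| ≤ F + β * |v m| := by
    have h3 := hφ m
    rw [hv] at h3
    calc |v m| = |f m (φ m) + β * M.applyP v m (φ m)| := by rw [← h3]
      _ ≤ |f m (φ m)| + |β * M.applyP v m (φ m)| := abs_add_le _ _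
      _ ≤ F + β * |v m| := by
        rw [abs_mul, abs_of_nonneg hβ]
        exact add_le_add (hF _ _) (mul_le_mul_of_nonneg_left h1 hβ)
  rw [abs_mul, abs_of_pos (by linarith)]
  have h4 := mul_le_mul_of_nonneg_left (hm s (Finset.mem_univ s)) (by linarith : 0 ≤ 1 - β)
  linarith

omit [Nonempty A] in
-- The average of a positive part is nonnegative, so the factor `β ≤ 1` can be dropped; the result
-- has the form required by `Matrix.exists_hitting_bound`.
theorem posPart_subsolution (π : StationaryPolicy S A) {β c : ℝ} (hβ : 0 ≤ β) (hβ1 : β ≤ 1)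
    (hc : 0 ≤ c) {w : S → ℝ} (hw : ∀ s, w s ≤ c + β * (M.chain π *ᵥ w) s) (s : S) :
    max (w s) 0 ≤ c + (M.chain π *ᵥ fun x => max (w x) 0) s := by
  have h1 := Matrix.mulVec_mono_of_mem_rowStochastic (M.chain_mem π) (u := w)
    (w := fun x => max (w x) 0) (fun x => le_max_left _ _) s
  have h2 : 0 ≤ (M.chain π *ᵥ fun x => max (w x) 0) s := by
    exact (Matrix.mulVec_const_of_mem_rowStochastic (M.chain_mem π) 0 s).ge.trans
      (Matrix.mulVec_mono_of_mem_rowStochastic (M.chain_mem π) (fun x => le_max_right _ _) s)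
  refine max_le ((hw s).trans ?_) (by linarith)
  nlinarith [mul_le_mul_of_nonneg_left h1 hβ, mul_le_of_le_one_left h2 hβ1]

/-- In a weakly communicating model, discounted optimal values have a span that is bounded
uniformly in the discount factor. -/
theorem WeaklyCommunicating.exists_span_bound {M : CMDP S A} (hwc : M.WeaklyCommunicating)
    (f : S → A → ℝ) : ∃ K F : ℝ, ∀ β : ℝ, 0 ≤ β → β < 1 → ∀ v : S → ℝ, M.bellman f β v = v →
      ∃ m : ℝ, |(1 - β) * m| ≤ F ∧ ∀ s, |v s - m| ≤ K := by
  classical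
  obtain ⟨π, C, hC, ht⟩ := hwc
  -- Two kinds of hitting bounds: under the communicating policy every single state of `C` is
  -- reached, whereas under an arbitrary deterministic policy only the set `C` is.
  have h0 : ∀ y, ∃ K : ℝ, 0 ≤ K ∧ (y ∈ C → ∀ (u : S → ℝ) (c : ℝ), 0 ≤ c → (∀ s, 0 ≤ u s) →
      (∀ s, u s ≤ c + (M.chain π *ᵥ u) s) → u y = 0 → ∀ s, u s ≤ K * c) := fun y => by
    by_cases hy : y ∈ C
    · obtain ⟨K, hK, h⟩ := Matrix.exists_hitting_bound (M.chain_mem π) (Z := {y})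
        fun x => ⟨y, rfl, hC.accessible_of_transient ht x hy⟩
      exact ⟨K, hK, fun _ u c hc hu h1 h2 => h u c hc hu h1 (by rintro _ rfl; exact h2)⟩
    · exact ⟨0, le_rfl, fun h => absurd h hy⟩
  have h1 := fun φ : S → A => Matrix.exists_hitting_bound
    (M.chain_mem (StationaryPolicy.deterministic φ)) (Z := C)
    fun x => M.exists_accessible_of_transient _ ht x
  choose K₀ hK₀ h0 using h0
  choose K₁ hK₁ h1 using h1
  set F : ℝ := ∑ s, ∑ a, |f s a| with hFdef
  have hF : ∀ s a, |f s a| ≤ F := fun s a =>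
    (Finset.single_le_sum (f := fun a => |f s a|) (fun _ _ => abs_nonneg _)
      (Finset.mem_univ a)).trans (Finset.single_le_sum (f := fun s => ∑ a, |f s a|)
        (fun _ _ => Finset.sum_nonneg fun _ _ => abs_nonneg _) (Finset.mem_univ s))
  have hF0 : 0 ≤ F := Finset.sum_nonneg fun _ _ => Finset.sum_nonneg fun _ _ => abs_nonneg _
  -- The state `y` and the greedy policy `φ` below depend on `β`; summing over all of them removes
  -- this dependence. The factor `2 * F` bounds the reward plus the term `(1 - β) v y`.
  refine ⟨(∑ y, K₀ y + ∑ φ, K₁ φ) * (2 * F), F, fun β hβ hβ1 v hv => ?_⟩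
  obtain ⟨y, hyC, hy⟩ := Set.exists_max_image C v (Set.toFinite C) hC.1
  have hm := M.abs_discounted_value_le hF hβ hβ1 hv y
  refine ⟨v y, hm, fun s => ?_⟩
  rw [abs_le] at hm
  obtain ⟨φ, hφ⟩ := M.exists_greedy f β v
  rw [hv] at hφ
  have hsub : ∀ π' : StationaryPolicy S A, M.chain π' *ᵥ (fun x => v x - v y) =
      fun s => (M.chain π' *ᵥ v) s - v y := fun π' => by
    change M.chain π' *ᵥ (v - fun _ => v y) = _
    rw [Matrix.mulVec_sub]
    funext s
    rw [Pi.sub_apply, Matrix.mulVec_const_of_mem_rowStochastic (M.chain_mem π')]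
  have hsub' : ∀ π' : StationaryPolicy S A, M.chain π' *ᵥ (fun x => v y - v x) =
      fun s => v y - (M.chain π' *ᵥ v) s := fun π' => by
    change M.chain π' *ᵥ ((fun _ => v y) - v) = _
    rw [Matrix.mulVec_sub]
    funext s
    rw [Pi.sub_apply, Matrix.mulVec_const_of_mem_rowStochastic (M.chain_mem π')]
  -- Under the greedy policy `v - v y` is a subsolution, nonpositive on `C` because `y` maximizes
  -- `v` there, so reaching `C` suffices.
  have hup : v s - v y ≤ K₁ φ * (2 * F) := by
    refine (le_max_left _ 0).trans (h1 φ (fun x => max (v x - v y) 0) (2 * F) (by positivity)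
      (fun _ => le_max_right _ _) (M.posPart_subsolution _ hβ hβ1.le (by positivity)
        fun x => ?_) (fun z hz => max_eq_right (sub_nonpos.2 (hy z hz))) s)
    simp only [hsub]
    rw [chain_mulVec, StationaryPolicy.avg_deterministic, hφ x]
    have := (abs_le.1 (hF x (φ x))).2
    linarith
  -- The communicating policy is suboptimal for the discounted problem, which makes `v y - v` a
  -- subsolution for its chain; that chain reaches `y` itself.
  have hlow : v y - v s ≤ K₀ y * (2 * F) := by
    refine (le_max_left _ 0).trans (h0 y hyC (fun x => max (v y - v x) 0) (2 * F) (by positivity)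
      (fun _ => le_max_right _ _) (M.posPart_subsolution _ hβ hβ1.le (by positivity)
        fun x => ?_) (by simp) s)
    simp only [hsub']
    rw [chain_mulVec]
    have h2 := π.avg_mono (f := fun s a => -F + β * M.applyP v s a) (f' := fun s _ => v s)
      (fun s a => by
        have h3 := M.le_bellman f β v s a
        rw [hv] at h3
        have := (abs_le.1 (hF s a)).1
        linarith) x
    rw [π.avg_of_state] at h2
    have h3 : π.avg (fun s a => -F + β * M.applyP v s a) x =
        -F + β * π.avg (M.applyP v) x := by
      simp only [StationaryPolicy.avg, mul_add, Finset.sum_add_distrib, ← Finset.sum_mul,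
        π.prob_sum, Finset.mul_sum]
      rw [one_mul]
      congr 1
      exact Finset.sum_congr rfl fun _ _ => by ring
    rw [h3] at h2
    linarith
  have e1 : K₁ φ ≤ ∑ φ, K₁ φ := Finset.single_le_sum (fun φ _ => hK₁ φ) (Finset.mem_univ φ)
  have e2 : K₀ y ≤ ∑ y, K₀ y := Finset.single_le_sum (fun y _ => hK₀ y) (Finset.mem_univ y)
  have e3 : 0 ≤ ∑ φ, K₁ φ := Finset.sum_nonneg fun φ _ => hK₁ φ
  have e4 : 0 ≤ ∑ y, K₀ y := Finset.sum_nonneg fun y _ => hK₀ y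
  rw [abs_le]
  constructor <;> nlinarith

/-- The average-reward optimality equation of a weakly communicating model. -/
theorem WeaklyCommunicating.exists_optimality_equation {M : CMDP S A}
    (hwc : M.WeaklyCommunicating) (f : S → A → ℝ) :
    ∃ (ρ : ℝ) (h : S → ℝ), ∀ s, M.bellman f 1 h s = ρ + h s := by
  obtain ⟨K, F, hKF⟩ := hwc.exists_span_bound f
  set β : ℕ → ℝ := fun k => 1 - 1 / ((k : ℝ) + 1) with hβdef
  have hβ0 : ∀ k, 0 ≤ β k := fun k => by
    have : 1 / ((k : ℝ) + 1) ≤ 1 := by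
      rw [div_le_one (by positivity)]
      linarith [(Nat.cast_nonneg k : (0 : ℝ) ≤ k)]
    simp only [hβdef]; linarith
  have hβ1 : ∀ k, β k < 1 := fun k => by
    have : 0 < 1 / ((k : ℝ) + 1) := by positivity
    simp only [hβdef]; linarith
  have hβlim : Tendsto β atTop (𝓝 1) := by
    simpa [hβdef] using (tendsto_one_div_add_atTop_nhds_zero_nat (𝕜 := ℝ)).const_sub 1
  -- Subtracting `m` from the discounted value gives a bounded relative value with bounded constant
  -- `(1 - β) m`. The limit of this equation along a convergent subsequence is the average-reward
  -- equation.
  have hex : ∀ k, ∃ p : (S → ℝ) × ℝ, p ∈ Metric.closedBall (0 : (S → ℝ) × ℝ) (max (max K 0) F) ∧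
      ∀ s, M.bellman f (β k) p.1 s = p.2 + p.1 s := fun k => by
    obtain ⟨v, hv⟩ := M.exists_discounted_value f (hβ0 k) (hβ1 k)
    obtain ⟨m, hm, hvm⟩ := hKF (β k) (hβ0 k) (hβ1 k) v hv
    refine ⟨(fun s => v s - m, (1 - β k) * m), ?_, fun s => ?_⟩
    · rw [mem_closedBall_zero_iff, Prod.norm_def]
      refine max_le (((pi_norm_le_iff_of_nonneg (le_max_right K 0)).2 fun s =>
        (hvm s).trans (le_max_left _ _)).trans (le_max_left _ _)) (hm.trans (le_max_right _ _))
    · have h2 : ∀ a, f s a + β k * M.applyP (fun s => v s - m) s a =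
          f s a + β k * M.applyP v s a - β k * m := fun a => by
        rw [M.applyP_sub v fun _ => m, applyP_const]; ring
      have h3 : M.bellman f (β k) (fun s => v s - m) s = M.bellman f (β k) v s - β k * m := by
        simp only [bellman, h2]
        exact (Finset.apply_sup'_eq_sup'_comp _ (fun x => x - β k * m)
          (fun x y => (max_sub_sub_right x y _).symm)).symm
      rw [h3, hv]
      ring
  choose p hp hpe using hex
  obtain ⟨q, -, ψ, hψ, hlim⟩ := (isCompact_closedBall _ _).tendsto_subseq hp
  refine ⟨q.2, q.1, fun s => ?_⟩
  have h1 : Tendsto (fun k => (p (ψ k)).1) atTop (𝓝 q.1) := (continuous_fst.tendsto q).comp hlim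
  have h2 : Tendsto (fun k => (p (ψ k)).2) atTop (𝓝 q.2) := (continuous_snd.tendsto q).comp hlim
  have h3 : ∀ x, Tendsto (fun k => (p (ψ k)).1 x) atTop (𝓝 (q.1 x)) := tendsto_pi_nhds.1 h1
  refine tendsto_nhds_unique (f := fun k => M.bellman f (β (ψ k)) (p (ψ k)).1 s) (l := atTop) ?_ ?_
  · simp only [bellman]
    refine Tendsto.finset_sup'_nhds_apply _ fun a _ => Tendsto.const_add _ ?_
    refine (hβlim.comp hψ.tendsto_atTop).mul ?_
    exact tendsto_finsetSum _ fun x _ => (h3 x).const_mul _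
  · simp only [hpe]
    exact h2.add (h3 s)

/-- In a weakly communicating model the optimal gain is constant, attained by a deterministic
policy, and satisfies the optimality inequality with some bias function. -/
theorem WeaklyCommunicating.exists_optimal {M : CMDP S A} (hwc : M.WeaklyCommunicating)
    (f : S → A → ℝ) :
    ∃ (ρ : ℝ) (h : S → ℝ) (φ : S → A), (∀ s a, f s a + M.applyP h s a ≤ ρ + h s) ∧
      (∀ π s, M.gain π f s ≤ ρ) ∧
      ∀ s, M.gain (StationaryPolicy.deterministic φ) f s = ρ := by
  obtain ⟨ρ, h, hb⟩ := hwc.exists_optimality_equation f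
  obtain ⟨φ, hφ⟩ := M.exists_greedy f 1 h
  have h1 : ∀ s a, f s a + M.applyP h s a ≤ ρ + h s := fun s a => by
    rw [← hb]; simpa using M.le_bellman f 1 h s a
  have h2 : ∀ π s, M.gain π f s ≤ ρ := fun π s => by
    refine M.gain_le_of_avg π (h := h) (fun s => ?_) s
    exact (π.avg_mono h1 s).trans_eq (by rw [π.avg_of_state fun s => ρ + h s])
  refine ⟨ρ, h, φ, h1, h2, fun s => le_antisymm (h2 _ s) ?_⟩
  refine M.le_gain_of_avg _ (h := h) (fun s => ?_) s
  rw [StationaryPolicy.avg_deterministic, ← hb, hφ, one_mul]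

end CMDP

/-! ### Minimizers of a finite maximum of affine functions on the half-line. -/

section FiniteMaxAffine

variable {ι : Type*} [Fintype ι] {c m : ι → ℝ} {D : ℝ → ℝ}

/-- A piece of positive slope makes `D` coercive, so compactness applies. Otherwise, far out, pieces
of negative slope lie below `B`, so the active piece is constant and its value is a global lower
bound. -/
theorem exists_min_of_finite_max_affine (hle : ∀ l i, c i + m i * l ≤ D l)
    (hex : ∀ l, ∃ i, D l = c i + m i * l) {B : ℝ} (hB : ∀ l, 0 ≤ l → B ≤ D l) :
    ∃ l, 0 ≤ l ∧ ∀ l', 0 ≤ l' → D l ≤ D l' := by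
  by_cases hpos : ∃ i, 0 < m i
  · obtain ⟨i, hi⟩ := hpos
    have : Nonempty ι := ⟨i⟩
    have hD : D = fun l => Finset.univ.sup' Finset.univ_nonempty fun i => c i + m i * l := by
      funext l
      refine le_antisymm ?_ (Finset.sup'_le _ _ fun i _ => hle l i)
      obtain ⟨j, hj⟩ := hex l
      rw [hj]
      exact Finset.le_sup' (fun i => c i + m i * l) (Finset.mem_univ j)
    have hcont : Continuous D := by
      rw [hD]
      exact Continuous.finset_sup'_apply _ fun i _ => by fun_prop
    obtain ⟨l₁, hl₁, hl₁0⟩ : ∃ l₁, (∀ l, l₁ ≤ l → D 0 ≤ c i + m i * l) ∧ 0 ≤ l₁ := by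
      have h : Tendsto (fun l => c i + m i * l) atTop atTop :=
        tendsto_atTop_add_const_left _ _ (tendsto_id.const_mul_atTop hi)
      obtain ⟨k, hk⟩ := eventually_atTop.1 (h.eventually_ge_atTop (D 0))
      exact ⟨max k 0, fun l hl => hk l ((le_max_left _ _).trans hl), le_max_right _ _⟩
    obtain ⟨l, hl, hmin⟩ := (isCompact_Icc (a := (0 : ℝ)) (b := l₁)).exists_isMinOn
      ⟨0, le_rfl, hl₁0⟩ hcont.continuousOn
    refine ⟨l, hl.1, fun l' hl' => ?_⟩
    rcases le_total l' l₁ with h | h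
    · exact hmin ⟨hl', h⟩
    · exact (hmin ⟨le_rfl, hl₁0⟩).trans ((hl₁ l' h).trans (hle l' i))
  · push Not at hpos
    have h : ∀ᶠ l in atTop, ∀ i, m i < 0 → c i + m i * l < B := by
      refine eventually_all.2 fun i => ?_
      by_cases hi : m i < 0
      · have h : Tendsto (fun l => c i + m i * l) atTop atBot :=
          tendsto_atBot_add_const_left _ _ (tendsto_id.const_mul_atTop_of_neg hi)
        filter_upwards [h.eventually_lt_atBot B] with l hl _ using hl
      · exact Eventually.of_forall fun l h => absurd h hi
    obtain ⟨l, hl, hl0⟩ := (h.and (eventually_ge_atTop 0)).exists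
    obtain ⟨i, hi⟩ := hex l
    have hmi : m i = 0 := by
      refine le_antisymm (hpos i) (not_lt.1 fun hneg => ?_)
      have := hl i hneg
      have := hB l hl0
      linarith
    refine ⟨l, hl0, fun l' _ => ?_⟩
    have := hle l' i
    rw [hmi] at this hi
    linarith

/-- If all active slopes were negative, a small step to the right would bring every piece below `D
l`: active ones by their slope, inactive ones by continuity. -/
theorem exists_active_slope_nonneg (hle : ∀ l i, c i + m i * l ≤ D l)
    (hex : ∀ l, ∃ i, D l = c i + m i * l) {l : ℝ} (hl : 0 ≤ l)
    (hmin : ∀ l', 0 ≤ l' → D l ≤ D l') : ∃ i, D l = c i + m i * l ∧ 0 ≤ m i := by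
  by_contra! hneg
  have h : ∀ᶠ l' in 𝓝[>] l, ∀ i, c i + m i * l' < D l := by
    refine eventually_all.2 fun i => ?_
    rcases (hle l i).eq_or_lt with h | h
    · filter_upwards [self_mem_nhdsWithin] with l' (hl' : l < l')
      nlinarith [hneg i h.symm]
    · have hc : Tendsto (fun l' => c i + m i * l') (𝓝 l) (𝓝 (c i + m i * l)) :=
        Continuous.tendsto (by fun_prop) l
      exact (hc.eventually_lt_const h).filter_mono nhdsWithin_le_nhds
  obtain ⟨l', h1, h2⟩ := (h.and self_mem_nhdsWithin).exists
  obtain ⟨i, hi⟩ := hex l'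
  have := hmin l' (hl.trans (le_of_lt h2))
  linarith [h1 i]

theorem exists_active_slope_nonpos (hle : ∀ l i, c i + m i * l ≤ D l)
    (hex : ∀ l, ∃ i, D l = c i + m i * l) {l : ℝ} (hl : 0 < l)
    (hmin : ∀ l', 0 ≤ l' → D l ≤ D l') : ∃ i, D l = c i + m i * l ∧ m i ≤ 0 := by
  by_contra! hpos
  have h : ∀ᶠ l' in 𝓝[<] l, ∀ i, c i + m i * l' < D l := by
    refine eventually_all.2 fun i => ?_
    rcases (hle l i).eq_or_lt with h | h
    · filter_upwards [self_mem_nhdsWithin] with l' (hl' : l' < l)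
      nlinarith [hpos i h.symm]
    · have hc : Tendsto (fun l' => c i + m i * l') (𝓝 l) (𝓝 (c i + m i * l)) :=
        Continuous.tendsto (by fun_prop) l
      exact (hc.eventually_lt_const h).filter_mono nhdsWithin_le_nhds
  -- Here `0 < l` is essential: the step to the left must stay in the half-line.
  obtain ⟨l', h1, h2⟩ := (h.and ((eventually_ge_nhds hl).filter_mono nhdsWithin_le_nhds)).exists
  obtain ⟨i, hi⟩ := hex l'
  have := hmin l' h2
  linarith [h1 i]

end FiniteMaxAffine

/-! ### Lagrangian duality. -/

namespace CMDP

variable {S A : Type*} [Fintype S] [DecidableEq S] [Fintype A] {M : CMDP S A}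

theorem lagrangian_eq_gain (s₁ : S) (π : StationaryPolicy S A) (lam : ℝ) :
    M.lagrangian s₁ π lam = M.gain π (fun s a => M.r s a + lam * (M.g s a - M.b)) s₁ := by
  rw [M.gain_add π M.r fun s a => lam * (M.g s a - M.b),
    M.gain_const_mul π lam fun s a => M.g s a - M.b]
  have h := M.gain_add π M.g (fun _ _ => -M.b) s₁
  rw [gain_const] at h
  simp only [← sub_eq_add_neg] at h
  rw [h, lagrangian]

theorem dual_eq_optimalGain (s₁ : S) (lam : ℝ) : M.dual s₁ lam = M.optimalGain s₁ lam := by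
  simp only [dual, optimalGain, lagrangian_eq_gain]

variable [Nonempty A]

/-- The dual function is a maximum over deterministic policies, and the Bellman optimality
inequality holds for the Lagrangian reward. -/
theorem WeaklyCommunicating.dual_spec (hwc : M.WeaklyCommunicating) (s₁ : S) (lam : ℝ) :
    (∀ π, M.lagrangian s₁ π lam ≤ M.dual s₁ lam) ∧
      (∃ φ : S → A, M.dual s₁ lam = M.lagrangian s₁ (StationaryPolicy.deterministic φ) lam) ∧
      ∃ v, M.BellmanInequality s₁ lam v := by
  obtain ⟨ρ, h, φ, hb, hle, heq⟩ :=
    hwc.exists_optimal fun s a => M.r s a + lam * (M.g s a - M.b)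
  have hle' : ∀ π, M.lagrangian s₁ π lam ≤ ρ := fun π => by
    rw [lagrangian_eq_gain]; exact hle π s₁
  have hbdd : BddAbove (Set.range fun π => M.lagrangian s₁ π lam) :=
    ⟨ρ, by rintro _ ⟨π, rfl⟩; exact hle' π⟩
  have hφ : M.lagrangian s₁ (StationaryPolicy.deterministic φ) lam = ρ := by
    rw [lagrangian_eq_gain]; exact heq s₁
  have : Nonempty (StationaryPolicy S A) := ⟨StationaryPolicy.deterministic φ⟩
  have hD : M.dual s₁ lam = ρ :=
    le_antisymm (ciSup_le hle') (hφ.symm.le.trans (le_ciSup hbdd _))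
  refine ⟨fun π => le_ciSup hbdd π, ⟨φ, hD.trans hφ.symm⟩, h, fun s a => ?_⟩
  rw [← dual_eq_optimalGain, hD]
  have := hb s a
  linarith

/-- A feasible policy has nonnegative Lagrangian for every `l ≥ 0`, which supplies the lower bound 0
for the dual. -/
theorem WeaklyCommunicating.exists_isOptimalDual (hwc : M.WeaklyCommunicating) {s₁ : S}
    (hfeas : M.Feasible s₁) : ∃ lam, M.IsOptimalDual s₁ lam := by
  classical
  obtain ⟨π, hπ⟩ := hfeas
  refine exists_min_of_finite_max_affine (ι := S → A)
    (c := fun φ => M.gain (StationaryPolicy.deterministic φ) M.r s₁)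
    (m := fun φ => M.gain (StationaryPolicy.deterministic φ) M.g s₁ - M.b)
    (D := M.dual s₁) (B := 0) (fun l φ => ?_) (fun l => ?_) (fun l hl => ?_)
  · have := (hwc.dual_spec s₁ l).1 (StationaryPolicy.deterministic φ)
    rw [lagrangian] at this
    linarith
  · obtain ⟨φ, hφ⟩ := (hwc.dual_spec s₁ l).2.1
    exact ⟨φ, by rw [hφ, lagrangian, mul_comm]⟩
  · refine le_trans ?_ ((hwc.dual_spec s₁ l).1 π)
    exact add_nonneg (M.gain_nonneg π (fun s a => (M.r_mem s a).1) s₁)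
      (mul_nonneg hl (sub_nonneg.2 hπ))

omit [Nonempty A] in
/-- A stationary measure on state-action pairs that charges all the moves of a communicating
policy is realized by a stationary policy, whatever the initial state. -/
theorem IsClosedIrreducible.exists_policy_gain_eq {π : StationaryPolicy S A} {C : Set S}
    (hC : M.IsClosedIrreducible π C)
    (ht : ∀ s ∉ C, ∀ π' : StationaryPolicy S A, M.IsTransient π' s) {x : S → A → ℝ}
    (hx0 : ∀ s a, 0 ≤ x s a) (hx1 : ∑ s, ∑ a, x s a = 1)
    (hstat : ∀ V : S → ℝ, ∑ s, ∑ a, x s a * M.applyP V s a = ∑ s, (∑ a, x s a) * V s)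
    (hpos : ∀ s ∈ C, ∀ a, 0 < π.prob s a → 0 < x s a) :
    ∃ π' : StationaryPolicy S A, ∀ f s, M.gain π' f s = ∑ y, ∑ a, x y a * f y a := by
  set N : S → ℝ := fun s => ∑ a, x s a with hN
  have hN0 : ∀ s, 0 ≤ N s := fun s => Finset.sum_nonneg fun a _ => hx0 s a
  -- The conditional action law of `x`. States without mass lie outside `C` by `hpos`, and any
  -- choice of actions would do there.
  let π' : StationaryPolicy S A :=
    { prob := fun s a => if N s = 0 then π.prob s a else x s a / N s
      prob_nonneg := fun s a => by
        split_ifs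
        · exact π.prob_nonneg s a
        · exact div_nonneg (hx0 s a) (hN0 s)
      prob_sum := fun s => by
        split_ifs with h
        · exact π.prob_sum s
        · rw [← Finset.sum_div]; exact div_self h }
  have hprob : ∀ s a, N s * π'.prob s a = x s a := fun s a => by
    by_cases h : N s = 0
    · rw [h, zero_mul]
      exact ((Finset.sum_eq_zero_iff_of_nonneg fun a _ => hx0 s a).1 h a (Finset.mem_univ a)).symm
    · change N s * (if N s = 0 then π.prob s a else x s a / N s) = x s a
      rw [if_neg h, mul_div_cancel₀ _ h]
  have hsum : ∀ f : S → A → ℝ, ∑ s, N s * π'.avg f s = ∑ s, ∑ a, x s a * f s a := fun f => by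
    refine Finset.sum_congr rfl fun s _ => ?_
    rw [StationaryPolicy.avg, Finset.mul_sum]
    exact Finset.sum_congr rfl fun a _ => by rw [← mul_assoc, hprob]
  obtain ⟨z, hz⟩ := hC.1
  -- Every chain enters `C` because the other states are transient, and inside `C` the policy `π'`
  -- can imitate each move of `π`.
  have hreach : ∀ s, M.Accessible π' s z := fun s => by
    obtain ⟨y, hy, hsy⟩ := M.exists_accessible_of_transient π' ht s
    refine hsy.trans ((hC.accessible hy hz).induction
      (p := fun w => w ∈ C ∧ M.Accessible π' y w) ⟨hy, Accessible.refl y⟩ ?_).2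
    rintro u w ⟨hu, hyu⟩ huw
    refine ⟨hC.2.1 u hu w (Accessible.of_chain_pos huw), hyu.trans (Accessible.of_chain_pos ?_)⟩
    simp only [chain, Matrix.of_apply] at huw ⊢
    obtain ⟨a, -, ha⟩ : ∃ a ∈ Finset.univ, 0 < π.prob u a * M.P u a w := by
      by_contra! hc
      exact absurd (Finset.sum_nonpos hc) (not_le.2 huw)
    have ha1 : 0 < π.prob u a :=
      lt_of_le_of_ne (π.prob_nonneg u a) fun h => by simp [← h] at ha
    have ha2 : 0 < M.P u a w := pos_of_mul_pos_right ha (π.prob_nonneg u a)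
    have ha3 : 0 < π'.prob u a := lt_of_le_of_ne (π'.prob_nonneg u a) fun h => by
      have h1 := hpos u hu a ha1
      rw [← hprob, ← h, mul_zero] at h1
      exact lt_irrefl _ h1
    exact lt_of_lt_of_le (mul_pos ha3 ha2) (Finset.single_le_sum
      (f := fun a => π'.prob u a * M.P u a w)
      (fun a _ => mul_nonneg (π'.prob_nonneg u a) (M.P_nonneg u a w)) (Finset.mem_univ a))
  refine ⟨π', fun f s => ?_⟩
  -- The gain is harmonic, hence constant by `hreach`; integrating the Poisson equation against the
  -- stationary `x` removes the bias and identifies the constant.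
  obtain ⟨hharm, w, hw⟩ := M.gain_poisson π' f
  have hconst := Matrix.harmonic_eq_of_accessible (M.chain_mem π') hharm hreach
  have h1 : ∑ y, N y * (M.chain π' *ᵥ w) y = ∑ y, N y * w y := by
    rw [← hstat w, chain_mulVec, hsum]
  rw [← hsum, hw]
  simp only [Pi.add_apply, Pi.sub_apply, mul_add, mul_sub, Finset.sum_add_distrib,
    Finset.sum_sub_distrib, h1, sub_self, add_zero]
  rw [hconst s]
  simp only [hconst, ← Finset.sum_mul]
  rw [hx1, one_mul]

omit [Nonempty A] in
theorem gain_le_optimalValue {s₁ : S} {π : StationaryPolicy S A}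
    (h : M.b ≤ M.gain π M.g s₁) : M.gain π M.r s₁ ≤ M.optimalValue s₁ := by
  refine le_csSup ⟨1, ?_⟩ ⟨π, h, rfl⟩
  rintro _ ⟨π', -, rfl⟩
  rw [← M.gain_const π' 1 s₁]
  exact M.gain_mono π' (π'.avg_mono fun s a => (M.r_mem s a).2) s₁

omit [Nonempty A] in
/-- Convex combinations of gains in which a communicating policy has positive weight are gains
of stationary policies. -/
theorem IsClosedIrreducible.exists_policy_convexComb {π₀ : StationaryPolicy S A} {C : Set S}
    (hC : M.IsClosedIrreducible π₀ C)
    (ht : ∀ s ∉ C, ∀ π' : StationaryPolicy S A, M.IsTransient π' s)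
    (π₁ π₂ : StationaryPolicy S A) (s₁ : S) {α β ε : ℝ} (hα : 0 ≤ α) (hβ : 0 ≤ β) (hε : 0 < ε)
    (h1 : α + β + ε = 1) : ∃ π' : StationaryPolicy S A, ∀ f, M.gain π' f s₁ =
      α * M.gain π₁ f s₁ + β * M.gain π₂ f s₁ + ε * M.gain π₀ f s₁ := by
  have hlin : ∀ F : S → A → ℝ, ∑ s, ∑ a, (α * M.occupation π₁ s₁ s a +
      β * M.occupation π₂ s₁ s a + ε * M.occupation π₀ s₁ s a) * F s a =
      α * ∑ s, ∑ a, M.occupation π₁ s₁ s a * F s a +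
      β * ∑ s, ∑ a, M.occupation π₂ s₁ s a * F s a +
      ε * ∑ s, ∑ a, M.occupation π₀ s₁ s a * F s a := fun F => by
    simp only [add_mul, Finset.sum_add_distrib, Finset.mul_sum, mul_assoc]
  obtain ⟨π', hπ'⟩ := hC.exists_policy_gain_eq ht
    (x := fun s a => α * M.occupation π₁ s₁ s a +
      β * M.occupation π₂ s₁ s a + ε * M.occupation π₀ s₁ s a)
    (fun s a => add_nonneg (add_nonneg (mul_nonneg hα (M.occupation_nonneg π₁ s₁ s a))
      (mul_nonneg hβ (M.occupation_nonneg π₂ s₁ s a)))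
      (mul_nonneg hε.le (M.occupation_nonneg π₀ s₁ s a)))
    (by
      have h := hlin fun _ _ => 1
      simp only [mul_one, sum_occupation] at h
      rw [h, h1])
    (fun V => by
      rw [hlin]
      simp only [sum_occupation_mul_applyP]
      simp only [add_mul, Finset.sum_add_distrib, ← Finset.mul_sum, mul_assoc])
    (fun s hs a ha => by
      have hp := mul_pos (hC.occupation_pos ht s₁ hs) ha
      rw [← occupation_eq] at hp
      have e1 := mul_nonneg hα (M.occupation_nonneg π₁ s₁ s a)
      have e2 := mul_nonneg hβ (M.occupation_nonneg π₂ s₁ s a)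
      have e3 := mul_pos hε hp
      linarith)
  exact ⟨π', fun f => by rw [hπ', hlin]; simp only [← gain_eq_sum_occupation]⟩

/-- Strong duality at a minimizer of the dual function. -/
theorem WeaklyCommunicating.dual_le_optimalValue (hwc : M.WeaklyCommunicating) {s₁ : S} {lam : ℝ}
    (hlam : M.IsOptimalDual s₁ lam) : M.dual s₁ lam ≤ M.optimalValue s₁ := by
  classical
  set c : (S → A) → ℝ := fun φ => M.gain (StationaryPolicy.deterministic φ) M.r s₁ with hc
  set m : (S → A) → ℝ := fun φ => M.gain (StationaryPolicy.deterministic φ) M.g s₁ - M.b with hm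
  have hle : ∀ l φ, c φ + m φ * l ≤ M.dual s₁ l := fun l φ => by
    have := (hwc.dual_spec s₁ l).1 (StationaryPolicy.deterministic φ)
    rw [lagrangian, mul_comm] at this
    exact this
  have hex : ∀ l, ∃ φ, M.dual s₁ l = c φ + m φ * l := fun l => by
    obtain ⟨φ, hφ⟩ := (hwc.dual_spec s₁ l).2.1
    exact ⟨φ, by rw [hφ, lagrangian, mul_comm]⟩
  obtain ⟨φ₁, hφ₁, hm₁⟩ := exists_active_slope_nonneg hle hex hlam.1 hlam.2
  have hfeas : ∀ φ, 0 ≤ m φ → c φ ≤ M.optimalValue s₁ := fun φ h =>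
    gain_le_optimalValue (sub_nonneg.1 h)
  -- If `lam = 0` or an active slope vanishes, a single deterministic policy is feasible and its
  -- reward gain equals the dual value. Only strictly opposite slopes require mixing.
  rcases hlam.1.eq_or_lt with h0 | h0
  · rw [hφ₁, ← h0, mul_zero, add_zero]
    exact hfeas φ₁ hm₁
  obtain ⟨φ₂, hφ₂, hm₂⟩ := exists_active_slope_nonpos hle hex h0 hlam.2
  rcases hm₁.eq_or_lt with h1 | h1
  · rw [hφ₁, ← h1, zero_mul, add_zero]
    exact hfeas φ₁ hm₁
  rcases hm₂.eq_or_lt with h2 | h2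
  · rw [hφ₂, h2, zero_mul, add_zero]
    exact hfeas φ₂ h2.ge
  obtain ⟨π₀, C, hC, ht⟩ := id hwc
  set m₀ := M.gain π₀ M.g s₁ - M.b with hm₀
  have hlim : Tendsto (fun ε : ℝ => (1 - ε) * M.dual s₁ lam + ε * M.lagrangian s₁ π₀ lam)
      (𝓝[>] 0) (𝓝 (M.dual s₁ lam)) := by
    have : Tendsto (fun ε : ℝ => (1 - ε) * M.dual s₁ lam + ε * M.lagrangian s₁ π₀ lam)
      (𝓝 0) (𝓝 ((1 - 0) * M.dual s₁ lam + 0 * M.lagrangian s₁ π₀ lam)) :=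
      Continuous.tendsto (by fun_prop) 0
    simpa using this.mono_left nhdsWithin_le_nhds
  have ev1 : ∀ᶠ ε : ℝ in 𝓝[>] 0, 0 < -(1 - ε) * m φ₂ - ε * m₀ := by
    have : Tendsto (fun ε : ℝ => -(1 - ε) * m φ₂ - ε * m₀)
      (𝓝 0) (𝓝 (-(1 - 0) * m φ₂ - 0 * m₀)) := Continuous.tendsto (by fun_prop) 0
    exact (this.eventually_const_lt (by linarith)).filter_mono nhdsWithin_le_nhds
  have ev2 : ∀ᶠ ε : ℝ in 𝓝[>] 0, 0 < (1 - ε) * m φ₁ + ε * m₀ := by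
    have : Tendsto (fun ε : ℝ => (1 - ε) * m φ₁ + ε * m₀)
      (𝓝 0) (𝓝 ((1 - 0) * m φ₁ + 0 * m₀)) := Continuous.tendsto (by fun_prop) 0
    exact (this.eventually_const_lt (by linarith)).filter_mono nhdsWithin_le_nhds
  refine le_of_tendsto hlim ?_
  filter_upwards [ev1, ev2, self_mem_nhdsWithin] with ε e1 e2 (hε : 0 < ε)
  have hd : 0 < m φ₁ - m φ₂ := by linarith
  -- The weights solve `α + β + ε = 1` together with zero total slack; they are positive for small
  -- `ε` because the two slopes have opposite strict signs.
  set α := (-(1 - ε) * m φ₂ - ε * m₀) / (m φ₁ - m φ₂) with hα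
  set β := ((1 - ε) * m φ₁ + ε * m₀) / (m φ₁ - m φ₂) with hβ
  have hsum : α + β + ε = 1 := by
    rw [hα, hβ]; field_simp; ring
  have hslope : α * m φ₁ + β * m φ₂ + ε * m₀ = 0 := by
    rw [hα, hβ]; field_simp; ring
  obtain ⟨π, hπ⟩ := hC.exists_policy_convexComb ht (StationaryPolicy.deterministic φ₁)
    (StationaryPolicy.deterministic φ₂) s₁ (div_pos e1 hd).le (div_pos e2 hd).le hε hsum
  have hg : M.gain π M.g s₁ = M.b := by
    have h3 := hπ M.g
    have h4 : M.gain π M.g s₁ = α * (m φ₁ + M.b) + β * (m φ₂ + M.b) + ε * (m₀ + M.b) := by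
      rw [h3]; simp only [hm, hm₀, sub_add_cancel]; rfl
    have h5 : M.gain π M.g s₁ = (α * m φ₁ + β * m φ₂ + ε * m₀) + (α + β + ε) * M.b := by
      rw [h4]; ring
    rw [h5, hslope, hsum]; ring
  have hr : M.gain π M.r s₁ = α * c φ₁ + β * c φ₂ + ε * M.gain π₀ M.r s₁ := hπ M.r
  -- With zero slack the reward gain equals the Lagrangian, which is the same mixture of the three
  -- Lagrangians; two of them equal the dual value.
  refine le_trans (le_of_eq ?_) (gain_le_optimalValue hg.ge)
  have hL : M.lagrangian s₁ π₀ lam = M.gain π₀ M.r s₁ + lam * m₀ := rfl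
  have h1ε : (1 - ε) = α + β := by linarith
  rw [h1ε, add_mul, hr, hL]
  have e3 : α * M.dual s₁ lam = α * (c φ₁ + m φ₁ * lam) := by rw [hφ₁]
  have e4 : β * M.dual s₁ lam = β * (c φ₂ + m φ₂ * lam) := by rw [hφ₂]
  linear_combination e3 + e4 + lam * hslope

end CMDP

/-! ### Exponential concentration of the noise along a trajectory. -/

/-- Hoeffding's lemma for a centred bounded function on a finite probability space. -/
theorem sum_mul_exp_le_of_mean_zero {ι : Type*} [Fintype ι] {p X : ι → ℝ} (hp : ∀ i, 0 ≤ p i)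
    (hp1 : ∑ i, p i = 1) {c : ℝ} (hX : ∀ i, |X i| ≤ c) (hmean : ∑ i, p i * X i = 0) (θ : ℝ) :
    ∑ i, p i * Real.exp (θ * X i) ≤ Real.exp (θ ^ 2 * c ^ 2 / 2) := by
  rcases lt_trichotomy c 0 with hc | rfl | hc
  · have : IsEmpty ι := ⟨fun i => by linarith [hX i, abs_nonneg (X i)]⟩
    simp at hp1
  · have h0 : ∀ i, X i = 0 := fun i => abs_nonpos_iff.1 (hX i)
    simp [h0, hp1]
  -- The exponential lies below its chord on `[-θ c, θ c]`; the mean-zero condition removes the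
  -- `sinh` part.
  have hconv : ∀ i, Real.exp (θ * X i) ≤
      (1 + X i / c) / 2 * Real.exp (θ * c) + (1 - X i / c) / 2 * Real.exp (-(θ * c)) := fun i => by
    obtain ⟨h1, h2⟩ := abs_le.1 (hX i)
    have h3 : X i / c ≤ 1 := (div_le_one hc).2 h2
    have h4 : -1 ≤ X i / c := by rw [le_div_iff₀ hc]; linarith
    have h := convexOn_exp.2 (Set.mem_univ (θ * c)) (Set.mem_univ (-(θ * c)))
      (by linarith : 0 ≤ (1 + X i / c) / 2) (by linarith : 0 ≤ (1 - X i / c) / 2) (by ring)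
    simp only [smul_eq_mul] at h
    have he : θ * X i = (1 + X i / c) / 2 * (θ * c) + (1 - X i / c) / 2 * (-(θ * c)) := by
      field_simp; ring
    rw [he]; exact h
  calc ∑ i, p i * Real.exp (θ * X i)
      ≤ ∑ i, p i * ((1 + X i / c) / 2 * Real.exp (θ * c) +
          (1 - X i / c) / 2 * Real.exp (-(θ * c))) :=
        Finset.sum_le_sum fun i _ => mul_le_mul_of_nonneg_left (hconv i) (hp i)
    _ = ∑ i, (p i * Real.cosh (θ * c) + (p i * X i) * (Real.sinh (θ * c) / c)) := by
        refine Finset.sum_congr rfl fun i _ => ?_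
        rw [Real.cosh_eq, Real.sinh_eq]
        field_simp
        ring
    _ = Real.cosh (θ * c) := by
        rw [Finset.sum_add_distrib, ← Finset.sum_mul, ← Finset.sum_mul, hp1, hmean]; ring
    _ ≤ Real.exp ((θ * c) ^ 2 / 2) := Real.cosh_le_exp_half_sq _
    _ = _ := by rw [mul_pow]

/-- Expectation of a function of a finitely-valued random variable. -/
theorem integral_comp_eq_sum {Ω κ : Type*} [MeasurableSpace Ω] (μ : Measure Ω)
    [IsProbabilityMeasure μ] [Fintype κ] {H : Ω → κ} (hH : ∀ k, MeasurableSet {ω | H ω = k})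
    (F : κ → ℝ) : Integrable (fun ω => F (H ω)) μ ∧
      ∫ ω, F (H ω) ∂μ = ∑ k, μ.real {ω | H ω = k} * F k := by
  classical
  have h : (fun ω => F (H ω)) = fun ω => ∑ k, ({ω | H ω = k}.indicator fun _ => F k) ω := by
    funext ω
    rw [Finset.sum_eq_single (H ω)]
    · simp
    · intro b _ hb; simp [hb.symm]
    · simp
  have hi : ∀ k, Integrable ({ω | H ω = k}.indicator fun _ => F k) μ := fun k =>
    (integrable_const _).indicator (hH k)
  rw [h]
  refine ⟨integrable_finsetSum _ fun k _ => hi k, ?_⟩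
  rw [integral_finsetSum _ fun k _ => hi k]
  refine Finset.sum_congr rfl fun k _ => ?_
  rw [integral_indicator (hH k), setIntegral_const, smul_eq_mul]

namespace CMDP

variable {S A : Type*} [Fintype S] [DecidableEq S] [Fintype A] {M : CMDP S A}

theorem le_span (v : S → ℝ) (x y : S) : v x - v y ≤ span v :=
  sub_le_sub (le_ciSup (Set.finite_range v).bddAbove x) (ciInf_le (Set.finite_range v).bddBelow y)

theorem abs_applyP_sub_le_span (v : S → ℝ) (s : S) (a : A) (y : S) :
    |M.applyP v s a - v y| ≤ span v := by
  have h : M.applyP v s a - v y = ∑ x, M.P s a x * (v x - v y) := by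
    simp only [mul_sub, Finset.sum_sub_distrib, ← Finset.sum_mul, M.P_sum, one_mul, applyP]
  have h1 : ∀ c : ℝ, c = ∑ x, M.P s a x * c := fun c => by
    rw [← Finset.sum_mul, M.P_sum, one_mul]
  rw [h, abs_le]
  constructor
  · rw [h1 (-span v)]
    refine Finset.sum_le_sum fun x _ => mul_le_mul_of_nonneg_left ?_ (M.P_nonneg s a x)
    linarith [le_span v y x]
  · conv_rhs => rw [h1 (span v)]
    exact Finset.sum_le_sum fun x _ => mul_le_mul_of_nonneg_left (le_span v x y) (M.P_nonneg s a x)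

namespace IsInteraction

variable {s₁ : S} {T : ℕ} {Ω : Type*} [MeasurableSpace Ω] {μ : Measure Ω}
  {s : ℕ → Ω → S} {a : ℕ → Ω → A}

/-- The history `(s 1, a 1, …, s t, a t)`. -/
def history (s : ℕ → Ω → S) (a : ℕ → Ω → A) (t : ℕ) (ω : Ω) : Finset.Icc 1 t → S × A :=
  fun i => (s i ω, a i ω)

theorem measurableSet_history (hI : M.IsInteraction s₁ T μ s a) {t : ℕ} (ht : t ≤ T)
    (h : Finset.Icc 1 t → S × A) : MeasurableSet {ω | history s a t ω = h} := by
  have he : {ω | history s a t ω = h} =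
      ⋂ i : Finset.Icc 1 t, {ω | s i ω = (h i).1} ∩ {ω | a i ω = (h i).2} := by
    ext ω
    simp [history, funext_iff, Prod.ext_iff]
  rw [he]
  refine MeasurableSet.iInter fun i => ?_
  have hi := Finset.mem_Icc.1 i.2
  exact (hI.measurable_state i (Finset.mem_Icc.2 ⟨hi.1, by omega⟩) _).inter
    (hI.measurable_action i (Finset.mem_Icc.2 ⟨hi.1, by omega⟩) _)

/-- Disintegration of the law of `(history, next state)`. -/
theorem integral_history_next [IsProbabilityMeasure μ] (hI : M.IsInteraction s₁ T μ s a) {t : ℕ}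
    (h1 : 1 ≤ t) (ht : t ≤ T) (F : (Finset.Icc 1 t → S × A) → S → ℝ) :
    Integrable (fun ω => F (history s a t ω) (s (t + 1) ω)) μ ∧
    ∫ ω, F (history s a t ω) (s (t + 1) ω) ∂μ =
      ∫ ω, ∑ y, M.P (s t ω) (a t ω) y * F (history s a t ω) y ∂μ := by
  classical
  have htm : t ∈ Finset.Icc 1 t := Finset.mem_Icc.2 ⟨h1, le_rfl⟩
  have hset : ∀ k : (Finset.Icc 1 t → S × A) × S,
      {ω | (history s a t ω, s (t + 1) ω) = k} =
        {ω | history s a t ω = k.1} ∩ {ω | s (t + 1) ω = k.2} := fun k => by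
    ext ω; simp [Prod.ext_iff]
  have hmeas : ∀ k : (Finset.Icc 1 t → S × A) × S,
      MeasurableSet {ω | (history s a t ω, s (t + 1) ω) = k} := fun k => by
    rw [hset]
    exact (hI.measurableSet_history ht k.1).inter
      (hI.measurable_state (t + 1) (Finset.mem_Icc.2 ⟨by omega, by omega⟩) _)
  obtain ⟨hi, he⟩ := integral_comp_eq_sum μ hmeas fun k => F k.1 k.2
  refine ⟨hi, he.trans ?_⟩
  have hr := (integral_comp_eq_sum μ (hI.measurableSet_history ht) fun h =>
    ∑ y, M.P (h ⟨t, htm⟩).1 (h ⟨t, htm⟩).2 y * F h y).2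
  refine Eq.trans ?_ hr.symm
  rw [Fintype.sum_prod_type]
  refine Finset.sum_congr rfl fun h _ => ?_
  rw [Finset.mul_sum]
  refine Finset.sum_congr rfl fun y _ => ?_
  -- `transition` takes sequences indexed by all of `ℕ`; the values beyond `t` are irrelevant and
  -- filled with the last entry of `h`.
  have htr := hI.transition t (Finset.mem_Icc.2 ⟨h1, ht⟩)
    (fun i => if hi : i ∈ Finset.Icc 1 t then (h ⟨i, hi⟩).1 else (h ⟨t, htm⟩).1)
    (fun i => if hi : i ∈ Finset.Icc 1 t then (h ⟨i, hi⟩).2 else (h ⟨t, htm⟩).2) y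
  have e : ∀ ω, (∀ i ∈ Finset.Icc 1 t,
      s i ω = (if hi : i ∈ Finset.Icc 1 t then (h ⟨i, hi⟩).1 else (h ⟨t, htm⟩).1) ∧
      a i ω = (if hi : i ∈ Finset.Icc 1 t then (h ⟨i, hi⟩).2 else (h ⟨t, htm⟩).2)) ↔
      history s a t ω = h := fun ω => by
    rw [funext_iff]
    constructor
    · intro H i
      have := H i i.2
      rw [dif_pos i.2, dif_pos i.2] at this
      exact Prod.ext this.1 this.2
    · intro H i hi
      rw [dif_pos hi, dif_pos hi, ← H ⟨i, hi⟩]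
      exact ⟨rfl, rfl⟩
  simp only [e] at htr
  rw [dif_pos htm, dif_pos htm] at htr
  have e2 : {ω | (history s a t ω, s (t + 1) ω) = (h, y)} =
      {ω | history s a t ω = h ∧ s (t + 1) ω = y} := hset (h, y)
  rw [e2, htr, mul_assoc]

/-- The martingale `∑ i ≤ t, ((P v)(s i, a i) - v (s (i + 1)))`. -/
noncomputable def noise (M : CMDP S A) (v : S → ℝ) (s : ℕ → Ω → S) (a : ℕ → Ω → A) (t : ℕ)
    (ω : Ω) : ℝ :=
  ∑ i ∈ Finset.Icc 1 t, (M.applyP v (s i ω) (a i ω) - v (s (i + 1) ω))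

/-- Conditionally on the history, the last increment is centred and bounded by `span v`, so
Hoeffding's lemma contributes one factor per step. -/
theorem integral_exp_noise_le [IsProbabilityMeasure μ] (hI : M.IsInteraction s₁ T μ s a)
    (v : S → ℝ) (θ : ℝ) (t : ℕ) (ht : t ≤ T) :
    Integrable (fun ω => Real.exp (θ * noise M v s a t ω)) μ ∧
    ∫ ω, Real.exp (θ * noise M v s a t ω) ∂μ ≤ Real.exp (t * (θ ^ 2 * span v ^ 2 / 2)) := by
  induction t with
  | zero => simp [noise]
  | succ t ih =>
    obtain ⟨ihi, ihle⟩ := ih (by omega)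
    have hmem : ∀ i ∈ Finset.Icc 1 t, i ∈ Finset.Icc 1 (t + 1) ∧ i + 1 ∈ Finset.Icc 1 (t + 1) :=
      fun i hi => by simp only [Finset.mem_Icc] at *; omega
    have htm : t + 1 ∈ Finset.Icc 1 (t + 1) := by simp
    -- The noise up to `t` involves `s (t + 1)`, so it is a function of the history of length `t +
    -- 1`, not `t`.
    set G : (Finset.Icc 1 (t + 1) → S × A) → ℝ := fun h =>
      ∑ i : Finset.Icc 1 t, (M.applyP v (h ⟨i, (hmem i i.2).1⟩).1 (h ⟨i, (hmem i i.2).1⟩).2 -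
        v (h ⟨i + 1, (hmem i i.2).2⟩).1) with hG
    have hGn : ∀ ω, G (history s a (t + 1) ω) = noise M v s a t ω := fun ω => by
      simp only [hG, history, noise]
      exact Finset.sum_coe_sort (Finset.Icc 1 t) fun i =>
        M.applyP v (s i ω) (a i ω) - v (s (i + 1) ω)
    obtain ⟨hi, he⟩ := hI.integral_history_next (t := t + 1) (by omega) ht fun h y =>
      Real.exp (θ * G h) *
        Real.exp (θ * (M.applyP v (h ⟨t + 1, htm⟩).1 (h ⟨t + 1, htm⟩).2 - v y))
    have hexp : ∀ ω, Real.exp (θ * noise M v s a (t + 1) ω) =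
        Real.exp (θ * noise M v s a t ω) * Real.exp (θ * (M.applyP v (s (t + 1) ω) (a (t + 1) ω) -
          v (s (t + 1 + 1) ω))) := fun ω => by
      rw [← Real.exp_add, ← mul_add, noise, Finset.sum_Icc_succ_top (by omega)]
      rfl
    simp only [hGn] at hi he
    simp only [hexp]
    refine ⟨hi, ?_⟩
    have hb : ∀ ω, ∑ y, M.P (s (t + 1) ω) (a (t + 1) ω) y * (Real.exp (θ * noise M v s a t ω) *
        Real.exp (θ * (M.applyP v (s (t + 1) ω) (a (t + 1) ω) - v y))) ≤
        Real.exp (θ * noise M v s a t ω) * Real.exp (θ ^ 2 * span v ^ 2 / 2) := fun ω => by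
      have h2 := sum_mul_exp_le_of_mean_zero (M.P_nonneg (s (t + 1) ω) (a (t + 1) ω))
        (M.P_sum _ _) (X := fun y => M.applyP v (s (t + 1) ω) (a (t + 1) ω) - v y)
        (fun y => abs_applyP_sub_le_span v _ _ y) (by
          simp only [mul_sub, Finset.sum_sub_distrib, ← Finset.sum_mul, M.P_sum, one_mul]
          exact sub_self _) θ
      refine le_trans (le_of_eq ?_) (mul_le_mul_of_nonneg_left h2 (Real.exp_pos _).le)
      rw [Finset.mul_sum]
      exact Finset.sum_congr rfl fun y _ => by ring
    have hint : Integrable (fun ω => ∑ y, M.P (s (t + 1) ω) (a (t + 1) ω) y *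
        (Real.exp (θ * noise M v s a t ω) *
          Real.exp (θ * (M.applyP v (s (t + 1) ω) (a (t + 1) ω) - v y)))) μ := by
      have h3 := (integral_comp_eq_sum μ (hI.measurableSet_history ht) fun h =>
        ∑ y, M.P (h ⟨t + 1, htm⟩).1 (h ⟨t + 1, htm⟩).2 y * (Real.exp (θ * G h) *
          Real.exp (θ * (M.applyP v (h ⟨t + 1, htm⟩).1 (h ⟨t + 1, htm⟩).2 - v y)))).1
      simp only [hGn] at h3
      exact h3
    calc _ = _ := he
      _ ≤ ∫ ω, Real.exp (θ * noise M v s a t ω) * Real.exp (θ ^ 2 * span v ^ 2 / 2) ∂μ :=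
        integral_mono hint (ihi.mul_const _) hb
      _ = (∫ ω, Real.exp (θ * noise M v s a t ω) ∂μ) * Real.exp (θ ^ 2 * span v ^ 2 / 2) :=
        integral_mul_const _ _
      _ ≤ Real.exp (t * (θ ^ 2 * span v ^ 2 / 2)) * Real.exp (θ ^ 2 * span v ^ 2 / 2) :=
        mul_le_mul_of_nonneg_right ihle (Real.exp_pos _).le
      _ = _ := by
        rw [← Real.exp_add]
        push_cast
        congr 1
        ring

/-- The Azuma–Hoeffding inequality for the martingale `noise`. -/
theorem measureReal_noise_lt_le [IsProbabilityMeasure μ] (hI : M.IsInteraction s₁ T μ s a)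
    (v : S → ℝ) {δ : ℝ} (hδ : 0 < δ) (hδ1 : δ ≤ 1) :
    μ.real {ω | noise M v s a T ω < -(span v * Real.sqrt (2 * (T : ℝ) * Real.log (1 / δ)))} ≤
      δ := by
  set L := Real.log (1 / δ) with hL
  have hL0 : 0 ≤ L := Real.log_nonneg (by rw [le_div_iff₀ hδ]; linarith)
  have hexpL : Real.exp (-L) = δ := by
    rw [hL, one_div, Real.log_inv, neg_neg, Real.exp_log hδ]
  have hspan : 0 ≤ span v := by simpa using le_span v s₁ s₁
  rcases Nat.eq_zero_or_pos T with rfl | hT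
  · simp [noise, hδ.le]
  rcases hspan.eq_or_lt with h0 | hpos
  · have hz : ∀ ω, noise M v s a T ω = 0 := fun ω => Finset.sum_eq_zero fun i _ =>
      abs_nonpos_iff.1 (h0 ▸ abs_applyP_sub_le_span v (s i ω) (a i ω) (s (i + 1) ω))
    simp [hz, ← h0, hδ.le]
  have hT' : (0 : ℝ) < T := by exact_mod_cast hT
  set R := Real.sqrt (2 * (T : ℝ) * L) with hR
  have hR2 : R ^ 2 = 2 * T * L := Real.sq_sqrt (by positivity)
  have hR0 : 0 ≤ R := Real.sqrt_nonneg _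
  -- The optimal Chernoff parameter, negative for a lower tail: the exponent is `-R² / T + R² / (2
  -- T) = -L`. The cases `T = 0` and `span v = 0`, where it is undefined, make the event empty.
  set θ : ℝ := -(R / (T * span v)) with hθ
  have hθ0 : θ ≤ 0 := neg_nonpos.2 (by positivity)
  obtain ⟨hint, hle⟩ := hI.integral_exp_noise_le v θ T le_rfl
  have h1 := ProbabilityTheory.measure_le_le_exp_mul_mgf (μ := μ) (X := noise M v s a T)
    (-(span v * R)) hθ0 hint
  have h2 : {ω | noise M v s a T ω < -(span v * R)} ⊆ {ω | noise M v s a T ω ≤ -(span v * R)} :=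
    fun ω hω => le_of_lt (Set.mem_ofPred_eq ▸ hω)
  refine (measureReal_mono h2).trans (h1.trans ?_)
  refine (mul_le_mul_of_nonneg_left hle (Real.exp_pos _).le).trans (le_of_eq ?_)
  rw [← Real.exp_add, ← hexpL]
  congr 1
  have e1 : -θ * -(span v * R) = -(R ^ 2 / T) := by
    rw [hθ]; field_simp
  have e2 : (T : ℝ) * (θ ^ 2 * span v ^ 2 / 2) = R ^ 2 / T / 2 := by
    rw [hθ]; field_simp
  rw [e1, e2, hR2]
  field_simp
  ring

end IsInteraction

/-- Summing the Bellman inequality along a trajectory. -/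
theorem BellmanInequality.regret_ge {s₁ : S} {lam : ℝ} {v : S → ℝ}
    (hv : M.BellmanInequality s₁ lam v) (hval : M.optimalGain s₁ lam ≤ M.optimalValue s₁) (T : ℕ)
    (s : ℕ → S) (a : ℕ → A) : M.regret s₁ T s a ≥ -lam * M.violation T s a
      + ∑ t ∈ Finset.Icc 1 T, (M.applyP v (s t) (a t) - v (s (t + 1))) - span v := by
  have h1 : ∀ t, M.optimalValue s₁ - M.r (s t) (a t) ≥ -lam * (M.b - M.g (s t) (a t)) +
      (M.applyP v (s t) (a t) - v (s (t + 1))) + (v (s (t + 1)) - v (s t)) := fun t => by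
    have := hv (s t) (a t)
    linarith
  have h2 := Finset.sum_le_sum fun t (_ : t ∈ Finset.Icc 1 T) => h1 t
  have h3 : ∀ n : ℕ, ∑ t ∈ Finset.Icc 1 n, (v (s (t + 1)) - v (s t)) = v (s (n + 1)) - v (s 1) := by
    intro n
    induction n with
    | zero => simp
    | succ n ih => rw [Finset.sum_Icc_succ_top (by omega), ih]; ring
  rw [Finset.sum_add_distrib, Finset.sum_add_distrib, h3, ← Finset.mul_sum] at h2
  have h4 := le_span v (s 1) (s (T + 1))
  unfold regret violation
  linarith

end CMDP

/-! ### The regret bound. -/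

theorem lemma8 {S A : Type*} [Fintype S] [DecidableEq S] [Fintype A]
    (M : CMDP S A) (s₁ : S) (hwc : M.WeaklyCommunicating) (hfeas : M.Feasible s₁) :
    (∃ lam : ℝ, M.IsOptimalDual s₁ lam) ∧
    ∀ lam : ℝ, M.IsOptimalDual s₁ lam →
      (∃ v : S → ℝ, M.BellmanInequality s₁ lam v) ∧
      ∀ v : S → ℝ, M.BellmanInequality s₁ lam v →
        ∀ (T : ℕ) (δ : ℝ), 0 < δ → δ ≤ 1 →
        ∀ (Ω : Type*) [MeasurableSpace Ω] (μ : Measure Ω) [IsProbabilityMeasure μ]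
          (s : ℕ → Ω → S) (a : ℕ → Ω → A), M.IsInteraction s₁ T μ s a →
          μ.real {ω | M.regret s₁ T (fun t => s t ω) (fun t => a t ω) ≥
            -lam * M.violation T (fun t => s t ω) (fun t => a t ω)
              - CMDP.span v * Real.sqrt (2 * (T : ℝ) * Real.log (1 / δ))
              - CMDP.span v} ≥ 1 - δ := by
  obtain ⟨a₀⟩ : Nonempty A := by
    obtain ⟨π, -⟩ := hfeas
    by_contra hA
    rw [not_nonempty_iff] at hA
    simpa using π.prob_sum s₁
  have : Nonempty A := ⟨a₀⟩
  refine ⟨hwc.exists_isOptimalDual hfeas, fun lam hlam => ⟨(hwc.dual_spec s₁ lam).2.2, ?_⟩⟩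
  intro v hv T δ hδ hδ1 Ω _ μ _ s a hI
  have hval : M.optimalGain s₁ lam ≤ M.optimalValue s₁ := by
    rw [← CMDP.dual_eq_optimalGain]
    exact hwc.dual_le_optimalValue hlam
  set good := {ω | M.regret s₁ T (fun t => s t ω) (fun t => a t ω) ≥
    -lam * M.violation T (fun t => s t ω) (fun t => a t ω)
      - CMDP.span v * Real.sqrt (2 * (T : ℝ) * Real.log (1 / δ)) - CMDP.span v} with hgood
  have hbad := hI.measureReal_noise_lt_le v hδ hδ1
  set bad := {ω | CMDP.IsInteraction.noise M v s a T ω <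
    -(CMDP.span v * Real.sqrt (2 * (T : ℝ) * Real.log (1 / δ)))} with hbaddef
  -- A covering is enough: subadditivity of the measure bounds `good` from below without
  -- measurability of either set.
  have hcover : good ∪ bad = Set.univ := by
    refine Set.eq_univ_of_forall fun ω => ?_
    by_cases hω : ω ∈ bad
    · exact Or.inr hω
    · left
      have h1 := not_lt.1 (Set.mem_ofPred_eq ▸ hω)
      have h2 := hv.regret_ge hval T (fun t => s t ω) (fun t => a t ω)
      unfold CMDP.IsInteraction.noise at h1
      rw [hgood, Set.mem_ofPred_eq]
      linarith
  have h1 := measureReal_union_le (μ := μ) good bad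
  rw [hcover, probReal_univ] at h1
  linarith
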